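/- Let $\mathbb{H}^{(2)}$ be the Siegel upper half space of degree $2$ (complex symmetric $2\times2$ matrices $Z=X+iY$ with $Y>0$), let $\Gamma=\mathrm{Sp}_2(\mathbb{Z})$ be the group of integral symplectic $4\times4$ matrices $M=\begin{pmatrix}A&B\\C&D\end{pmatrix}$, acting by $M\bullet Z=(AZ+B)(CZ+D)^{-1}$, and let $\Delta=\left\{\begin{pmatrix}I&B\\0&I\end{pmatrix} : B\in\mathrm{Mat}_2(\mathbb{Z}),\ {}^tB=B\right\}$. For $w\in\mathbb{Z}$ and a function $F$ on $\mathbb{H}^{(2)}$ put $(F|_wM)(Z)=\det(CZ+D)^{-w}F(M\bullet Z)$. For positive definite symmetric real $2\times 2$ matrices $T,T'$ put $$\Psi_k(T;Z)=\det(TY)\,h_{k+1,1}(T;Y)\,e^{2\pi i\,\mathrm{tr}(TX)},\qquad \Phi_\ell(T';Z)=e^{2\pi i\,\mathrm{tr}(T'Z)},$$ $$h_{\alpha,\beta}(T;Y)=\int_{U\pm T>0}\det(U+T)^{\alpha-\frac32}\det(U-T)^{\beta-\frac32}e^{-2\pi\,\mathrm{tr}(YU)}\,dU,$$ where $U$ runs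 over real symmetric $2\times2$ matrices and $dU=du_{11}\,du_{12}\,du_{22}$. For half-integral $T,T'$ (integral diagonal entries, off-diagonal entries in $\frac12\mathbb{Z}$) and positive even integers $k,\ell$ define $$P^{(2)}_{k,\ell;T,T'}(Z)=\sum_{M\in\Delta\backslash\Gamma}\bigl(\Psi_k(T;\cdot)\,\Phi_\ell(T';\cdot)\bigr)\big|_{k+\ell}M\,(Z).$$ **Theorem.** There is a real number $y_0>1$ such that for every positive even integer $k$ and all positive definite, symmetric, half-integral $2\times2$ matrices $T,T'$ the following hold. 1. As $\ell\to\infty$ through the even integers, $P^{(2)}_{k,\ell;T,T'}(iy_0I)$ converges to a positive real number. 2. There is $\ell_0$ (depending on $k,T,T'$) such that for every even $\ell\ge\ell_0$ the series $P^{(2)}_{k,\ell;T,T'}(Z)$ converges absolutely for every $Z\in\mathbb{H}^{(2)}$, and $P^{(2)}_{k,\ell;T,T'}$ does not vanish identically on $\mathbb{H}^{(2)}$. -/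

import Mathlib

open Matrix Filter Topology MeasureTheory

noncomputable section

namespace SiegelPoincare

/-- Integral, real and complex `2 × 2` matrices are written `Mat2 R`. -/
abbrev Mat2 (R : Type) : Type := Matrix (Fin 2) (Fin 2) R

/-- Real part `X` of `Z = X + iY`. -/
def reMat (Z : Mat2 ℂ) : Mat2 ℝ := Z.map Complex.re

/-- Imaginary part `Y` of `Z = X + iY`. -/
def imMat (Z : Mat2 ℂ) : Mat2 ℝ := Z.map Complex.im

/-- A real matrix viewed as a complex matrix. -/
def toC (T : Mat2 ℝ) : Mat2 ℂ := T.map (fun x : ℝ => (x : ℂ))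

/-- An integral matrix viewed as a complex matrix. -/
def intToC (B : Mat2 ℤ) : Mat2 ℂ := B.map (fun n : ℤ => (n : ℂ))

/-- The Siegel upper half space of degree two. -/
def upperHalfSpace : Set (Mat2 ℂ) := {Z | Z.IsSymm ∧ (imMat Z).PosDef}

/-- The full Siegel modular group `Sp₂(ℤ)` (of `4 × 4` matrices). -/
abbrev Gam : Type := Matrix.symplecticGroup (Fin 2) ℤ

/-- The block `A` of `M = (A B; C D)`, as a complex matrix. -/
def blockA (M : Gam) : Mat2 ℂ := intToC (M : Matrix (Fin 2 ⊕ Fin 2) (Fin 2 ⊕ Fin 2) ℤ).toBlocks₁₁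

/-- The block `B` of `M`. -/
def blockB (M : Gam) : Mat2 ℂ := intToC (M : Matrix (Fin 2 ⊕ Fin 2) (Fin 2 ⊕ Fin 2) ℤ).toBlocks₁₂

/-- The block `C` of `M`. -/
def blockC (M : Gam) : Mat2 ℂ := intToC (M : Matrix (Fin 2 ⊕ Fin 2) (Fin 2 ⊕ Fin 2) ℤ).toBlocks₂₁

/-- The block `D` of `M`. -/
def blockD (M : Gam) : Mat2 ℂ := intToC (M : Matrix (Fin 2 ⊕ Fin 2) (Fin 2 ⊕ Fin 2) ℤ).toBlocks₂₂

/-- The denominator `CZ + D`. -/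
def denom (M : Gam) (Z : Mat2 ℂ) : Mat2 ℂ := blockC M * Z + blockD M

/-- The action `M • Z = (AZ + B)(CZ + D)⁻¹`. -/
def act (M : Gam) (Z : Mat2 ℂ) : Mat2 ℂ := (blockA M * Z + blockB M) * (denom M Z)⁻¹

/-- The slash action `(F |ₖ M)(Z) = det(CZ + D)⁻ᵏ F(M • Z)`. -/
def slash (k : ℤ) (F : Mat2 ℂ → ℂ) (M : Gam) (Z : Mat2 ℂ) : ℂ :=
  (denom M Z).det ^ (-k) * F (act M Z)

/-- The subgroup `Δ` of all translations `(I B; 0 I)` with `B` integral and symmetric. -/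
def translations : Subgroup Gam where
  carrier := {M | ∃ B : Mat2 ℤ, B.IsSymm ∧
    (M : Matrix (Fin 2 ⊕ Fin 2) (Fin 2 ⊕ Fin 2) ℤ) = fromBlocks 1 B 0 1}
  one_mem' := ⟨0, by simp [Matrix.IsSymm], by simp⟩
  mul_mem' := by
    rintro M N ⟨B, hB, hM⟩ ⟨B', hB', hN⟩
    refine ⟨B' + B, hB'.add hB, ?_⟩
    rw [Submonoid.coe_mul, hM, hN, fromBlocks_multiply]
    simp
  inv_mem' := by
    rintro M ⟨B, hB, hM⟩
    refine ⟨-B, hB.neg, ?_⟩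
    rw [SymplecticGroup.coe_inv, hM, J, fromBlocks_transpose, fromBlocks_neg, fromBlocks_multiply,
      fromBlocks_multiply]
    simp [hB.eq]

theorem mem_translations {M : Gam} : M ∈ translations ↔ ∃ B : Mat2 ℤ, B.IsSymm ∧
    (M : Matrix (Fin 2 ⊕ Fin 2) (Fin 2 ⊕ Fin 2) ℤ) = fromBlocks 1 B 0 1 := Iff.rfl

/-- Half-integral symmetric matrices: integral diagonal, off-diagonal entries in `½ℤ`. -/
def IsHalfIntegral (T : Mat2 ℝ) : Prop :=
  T.IsSymm ∧ (∀ i, ∃ n : ℤ, T i i = n) ∧ ∀ i j, ∃ n : ℤ, 2 * T i j = n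

/-- The symmetric `2 × 2` matrix with upper triangular entries `u₁₁, u₁₂, u₂₂`. -/
def symMat (u : ℝ × ℝ × ℝ) : Mat2 ℝ := !![u.1, u.2.1; u.2.1, u.2.2]

/-- The confluent hypergeometric function
`h_{α,β}(T;Y) = ∫ det(U+T)^{α-3/2} det(U-T)^{β-3/2} e^{-2π tr(YU)} dU`,
where `U` runs over the real symmetric matrices with `U + T > 0` and `U - T > 0`, and
`dU = du₁₁ du₁₂ du₂₂`. -/
def hFun (α β : ℝ) (T Y : Mat2 ℝ) : ℝ :=
  ∫ u in {u : ℝ × ℝ × ℝ | (symMat u + T).PosDef ∧ (symMat u - T).PosDef},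
    (symMat u + T).det ^ (α - 3 / 2) * (symMat u - T).det ^ (β - 3 / 2) *
      Real.exp (-2 * Real.pi * (Y * symMat u).trace)

/-- `Ψₖ(T;Z) = det(TY) h_{k+1,1}(T;Y) e^{2πi tr(TX)}`. -/
def Psi (k : ℕ) (T : Mat2 ℝ) (Z : Mat2 ℂ) : ℂ :=
  (((T * imMat Z).det * hFun (k + 1) 1 T (imMat Z) : ℝ) : ℂ) *
    Complex.exp (2 * Real.pi * Complex.I * ((T * reMat Z).trace : ℝ))

/-- `Φ_ℓ(T;Z) = e^{2πi tr(TZ)}`, which does not depend on the weight `ℓ`. -/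
def Phi (T : Mat2 ℝ) (Z : Mat2 ℂ) : ℂ :=
  Complex.exp (2 * Real.pi * Complex.I * (toC T * Z).trace)

/-- The product `Ψₖ(T;Z) Φ_ℓ(T';Z)`. -/
def seed (k : ℕ) (T T' : Mat2 ℝ) (Z : Mat2 ℂ) : ℂ := Psi k T Z * Phi T' Z

theorem imMat_add_intToC (Z : Mat2 ℂ) (B : Mat2 ℤ) : imMat (Z + intToC B) = imMat Z := by
  ext i j
  simp [imMat, intToC]

theorem exists_trace_eq {T : Mat2 ℝ} (hT : IsHalfIntegral T) {B : Mat2 ℤ} (hB : B.IsSymm) :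
    ∃ n : ℤ, (T * B.map (fun m : ℤ => (m : ℝ))).trace = n := by
  obtain ⟨hs, hd, ho⟩ := hT
  obtain ⟨a, ha⟩ := hd 0
  obtain ⟨b, hb⟩ := hd 1
  obtain ⟨c, hc⟩ := ho 0 1
  have h1 : T 1 0 = T 0 1 := hs.apply 0 1
  have h2 : B 1 0 = B 0 1 := hB.apply 0 1
  refine ⟨a * B 0 0 + b * B 1 1 + c * B 0 1, ?_⟩
  simp only [Matrix.trace_fin_two, Matrix.mul_apply, Fin.sum_univ_two, Matrix.map_apply, h1, h2, ha,
    hb]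
  push_cast
  rw [← hc]
  ring

theorem Psi_add {k : ℕ} {T : Mat2 ℝ} (hT : IsHalfIntegral T) (Z : Mat2 ℂ) {B : Mat2 ℤ}
    (hB : B.IsSymm) : Psi k T (Z + intToC B) = Psi k T Z := by
  obtain ⟨n, hn⟩ := exists_trace_eq hT hB
  have h : reMat (Z + intToC B) = reMat Z + B.map (fun m : ℤ => (m : ℝ)) := by
    ext i j
    simp [reMat, intToC]
  rw [Psi, imMat_add_intToC, h, Matrix.mul_add, Matrix.trace_add, hn, Psi]
  congr 1
  rw [Complex.exp_eq_exp_iff_exists_int]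
  exact ⟨n, by push_cast; ring⟩

theorem Phi_add {T : Mat2 ℝ} (hT : IsHalfIntegral T) (Z : Mat2 ℂ) {B : Mat2 ℤ}
    (hB : B.IsSymm) : Phi T (Z + intToC B) = Phi T Z := by
  obtain ⟨n, hn⟩ := exists_trace_eq hT hB
  have h : (toC T * intToC B).trace = (n : ℂ) := by
    have := congrArg (fun x : ℝ => (x : ℂ)) hn
    simpa [toC, intToC, Matrix.trace_fin_two, Matrix.mul_apply, Fin.sum_univ_two] using this
  rw [Phi, Matrix.mul_add, Matrix.trace_add, h, Phi, Complex.exp_eq_exp_iff_exists_int]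
  exact ⟨n, by ring⟩

theorem intToC_mul (P Q : Mat2 ℤ) : intToC (P * Q) = intToC P * intToC Q := by
  ext i j
  simp [intToC, Matrix.mul_apply]

theorem intToC_add (P Q : Mat2 ℤ) : intToC (P + Q) = intToC P + intToC Q := by
  ext i j
  simp [intToC]

/-- Left multiplication by `(I B; 0 I)` leaves `C`, `D` fixed and changes `A`, `B`. -/
theorem blocks_translate {M N : Gam} {B : Mat2 ℤ}
    (h : ((N * M⁻¹ : Gam) : Matrix (Fin 2 ⊕ Fin 2) (Fin 2 ⊕ Fin 2) ℤ) = fromBlocks 1 B 0 1) :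
    blockA N = blockA M + intToC B * blockC M ∧ blockB N = blockB M + intToC B * blockD M ∧
      blockC N = blockC M ∧ blockD N = blockD M := by
  have hN : (N : Matrix (Fin 2 ⊕ Fin 2) (Fin 2 ⊕ Fin 2) ℤ) =
      fromBlocks 1 B 0 1 * (M : Matrix (Fin 2 ⊕ Fin 2) (Fin 2 ⊕ Fin 2) ℤ) := by
    rw [← h, ← Submonoid.coe_mul, inv_mul_cancel_right]
  simp only [blockA, blockB, blockC, blockD, hN]
  generalize (M : Matrix (Fin 2 ⊕ Fin 2) (Fin 2 ⊕ Fin 2) ℤ) = P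
  have hP : fromBlocks 1 B 0 1 * P =
      fromBlocks (P.toBlocks₁₁ + B * P.toBlocks₂₁) (P.toBlocks₁₂ + B * P.toBlocks₂₂)
        P.toBlocks₂₁ P.toBlocks₂₂ := by
    conv_lhs => rw [← fromBlocks_toBlocks P, fromBlocks_multiply]
    simp
  rw [hP]
  simp only [toBlocks_fromBlocks₁₁, toBlocks_fromBlocks₁₂, toBlocks_fromBlocks₂₁,
    toBlocks_fromBlocks₂₂, intToC_add, intToC_mul, and_self]

theorem seed_add {k : ℕ} {T T' : Mat2 ℝ} (hT : IsHalfIntegral T) (hT' : IsHalfIntegral T')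
    (Z : Mat2 ℂ) {B : Mat2 ℤ} (hB : B.IsSymm) :
    seed k T T' (Z + intToC B) = seed k T T' Z := by
  rw [seed, Psi_add hT Z hB, Phi_add hT' Z hB, seed]

/-- The terms of the Poincaré series are constant on the cosets `ΔM`. -/
theorem slash_seed_eq (w : ℤ) (k : ℕ) {T T' : Mat2 ℝ} (hT : IsHalfIntegral T)
    (hT' : IsHalfIntegral T') (Z : Mat2 ℂ) (M N : Gam)
    (h : N * M⁻¹ ∈ translations) :
    slash w (seed k T T') M Z = slash w (seed k T T') N Z := by
  obtain ⟨B, hB, hM⟩ := mem_translations.1 h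
  obtain ⟨hA, hB', hC, hD⟩ := blocks_translate hM
  have hden : denom N Z = denom M Z := by rw [denom, hC, hD, denom]
  have hnum : blockA N * Z + blockB N =
      (blockA M * Z + blockB M) + intToC B * denom M Z := by
    rw [hA, hB', denom, Matrix.add_mul, Matrix.mul_add, Matrix.mul_assoc]
    abel
  rw [slash, slash, hden]
  refine congrArg (fun x => (denom M Z).det ^ (-w) * x) ?_
  rw [act, act, hden, hnum]
  by_cases hd : IsUnit (denom M Z).det
  · rw [Matrix.add_mul (blockA M * Z + blockB M), Matrix.mul_nonsing_inv_cancel_right _ _ hd,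
      seed_add hT hT' _ hB]
  · rw [Matrix.nonsing_inv_apply_not_isUnit _ hd, Matrix.mul_zero, Matrix.mul_zero]

/-- The term `((Ψₖ(T;·) Φ_ℓ(T';·)) |_{k+ℓ} M)(Z)` that belongs to the coset `ΔM` in `Δ \ Γ`. -/
def poincareTerm (k l : ℕ) (T T' : Mat2 ℝ) (hT : IsHalfIntegral T) (hT' : IsHalfIntegral T')
    (Z : Mat2 ℂ) (q : Quotient (QuotientGroup.rightRel translations)) : ℂ :=
  Quotient.lift (fun M : Gam => slash ((k : ℤ) + l) (seed k T T') M Z)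
    (fun M N h => slash_seed_eq ((k : ℤ) + l) k hT hT' Z M N (QuotientGroup.rightRel_apply.1 h)) q

/-- The Siegel-Poincaré series
`P_{k,ℓ;T,T'}(Z) = ∑_{M ∈ Δ \ Γ} ((Ψₖ(T;·) Φ_ℓ(T';·)) |_{k+ℓ} M)(Z)`. -/
def poincareSeries (k l : ℕ) (T T' : Mat2 ℝ) (hT : IsHalfIntegral T) (hT' : IsHalfIntegral T')
    (Z : Mat2 ℂ) : ℂ :=
  ∑' q, poincareTerm k l T T' hT hT' Z q

end SiegelPoincare

end

/-!
The proof uses `y₀ = 2`. For a symplectic matrix `M` with bottom row `(C, D)` put `W = CZ + D`; the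
cosets in `Δ \ Γ` correspond to the bottom rows (`mul_inv_mem_translations`), so the series is a sum
over a subset of `ℤ⁸`.

*The seed.* For `U = T + V` with `V > 0` the integrand of `h_{k+1,1}(T;Y)` is bounded, up to a power
of `1 + tr Y / det Y`, by a translate of the fixed function `coneBound`, whose integrability reduces
to the arcsine integral (`integrable_coneBound`, `exists_hIntegrand_le`). Hence `h_{k+1,1}` is a
convergent integral and positive (`hFun_pos`), and the seed is bounded by a polynomial in `tr Y`,
`det Y`, `1 / det Y` times `exp(-c tr Y)` (`exists_norm_seed_le`).

*Absolute convergence.* One has `Im(M • Z) = W^{-*} Y W⁻¹` (`toC_imMat_act`). Since a `2 × 2` matrix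
and its adjugate have the same Frobenius norm, `tr Im(M • Z)` is at least a constant times
`|W|² / |det W|²` (`le_trace_imMat_act`). The exponential decay of the seed therefore bounds the
term of `M` by a constant times `|W|^{-16}` once `ℓ ≥ 3k + 24` (`exists_norm_slash_seed_le`); no
reduction theory is needed. As `|W|` dominates all entries of `C` and `D`, the sum over `ℤ⁸`
converges (`summable_norm_poincareTerm`).

*The limit.* At `Z = 2iI` one has `|det W|² = 16 det(C)² + 4 |adj(C) D|² + det(D)²` with integral
entries, so `|det W| > 1` if `C ≠ 0` and `|det W| = 1` if `C = 0` (`one_lt_norm_det_denom`,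
`det_denom_of_blockC_eq_zero`). Each term with `C ≠ 0` tends to zero as `ℓ → ∞`, and each term with
`C = 0` is independent of the even number `ℓ` and positive (`seed_act_pos`). The terms decrease in
absolute value as `ℓ` grows, so dominated convergence gives the limit, which is positive; the values
at `2iI` are then eventually nonzero.
-/

noncomputable section

namespace SiegelPoincare

/-! ### Positive definite real `2 × 2` matrices -/

theorem posDef_fin_two_iff {M : Mat2 ℝ} :
    M.PosDef ↔ M 1 0 = M 0 1 ∧ 0 < M 0 0 ∧ 0 < M 1 1 ∧ M 0 1 ^ 2 < M 0 0 * M 1 1 := by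
  constructor
  · intro h
    have hs : M 1 0 = M 0 1 := by simpa using h.isHermitian.apply 0 1
    have hd := h.det_pos
    rw [Matrix.det_fin_two, hs] at hd
    exact ⟨hs, h.diag_pos, h.diag_pos, by nlinarith⟩
  · rintro ⟨hs, h0, h1, hd⟩
    refine PosDef.of_dotProduct_mulVec_pos ?_ ?_
    · ext i j
      fin_cases i <;> fin_cases j <;> simp [hs]
    · intro x hx
      simp only [dotProduct, mulVec, Fin.sum_univ_two, Pi.star_apply, star_trivial, hs]
      have key : M 0 0 * (x 0 * (M 0 0 * x 0 + M 0 1 * x 1) + x 1 * (M 0 1 * x 0 + M 1 1 * x 1)) =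
          (M 0 0 * x 0 + M 0 1 * x 1) ^ 2 + (M 0 0 * M 1 1 - M 0 1 ^ 2) * x 1 ^ 2 := by ring
      refine pos_of_mul_pos_right (a := M 0 0) ?_ h0.le
      rw [key]
      by_cases hx1 : x 1 = 0
      · have hx0 : x 0 ≠ 0 := fun h => hx (by ext i; fin_cases i <;> simp [h, hx1])
        rw [hx1]
        have : 0 < (M 0 0 * x 0) ^ 2 := by positivity
        simpa using this
      · have : 0 < (M 0 0 * M 1 1 - M 0 1 ^ 2) * x 1 ^ 2 := by
          have : 0 < M 0 0 * M 1 1 - M 0 1 ^ 2 := by linarith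
          positivity
        positivity

/-- If `Y` has positive trace, then `tr(Y) tr(YV) ≥ det(Y) tr(V)` for positive semidefinite
`V = (a b; b c)`, because `tr(Y) Y - det(Y) I = Y²` by Cayley–Hamilton. -/
theorem det_div_trace_mul_le {p q r a b c : ℝ} (hY : 0 < p + r) (ha : 0 ≤ a) (hc : 0 ≤ c)
    (hb : b ^ 2 ≤ a * c) :
    (p * r - q ^ 2) / (p + r) * (a + c) ≤ p * a + 2 * q * b + r * c := by
  have quad : ∀ x y : ℝ, 0 ≤ x ^ 2 * a + 2 * x * y * b + y ^ 2 * c := by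
    intro x y
    rcases ha.eq_or_lt with rfl | ha
    · have : b = 0 := by nlinarith [sq_nonneg b]
      subst this
      nlinarith [mul_nonneg (sq_nonneg y) hc]
    · refine nonneg_of_mul_nonneg_right (a := a) ?_ ha
      nlinarith [sq_nonneg (a * x + b * y), mul_nonneg (sq_nonneg y) (sub_nonneg.2 hb)]
  rw [div_mul_eq_mul_div, div_le_iff₀ hY]
  nlinarith [quad p q, quad q r]

/-! ### The dominating function for the confluent hypergeometric integral -/

theorem hasDerivAt_arcsin_div {r x : ℝ} (hr : 0 < r) (hx : x ∈ Set.Ioo (-r) r) :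
    HasDerivAt (fun b => Real.arcsin (b / r)) ((r ^ 2 - x ^ 2) ^ (-(1 / 2) : ℝ)) x := by
  have h1 : -1 < x / r := by rw [lt_div_iff₀ hr]; linarith [hx.1]
  have h2 : x / r < 1 := by rw [div_lt_iff₀ hr]; linarith [hx.2]
  have h := (Real.hasDerivAt_arcsin h1.ne' h2.ne).comp x ((hasDerivAt_id x).div_const r)
  refine h.congr_deriv ?_
  have hp : 0 < r ^ 2 - x ^ 2 := by nlinarith [hx.1, hx.2]
  rw [Real.rpow_neg hp.le, ← Real.sqrt_eq_rpow,
    show 1 - (x / r) ^ 2 = (r ^ 2 - x ^ 2) / r ^ 2 by field_simp, Real.sqrt_div hp.le,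
    Real.sqrt_sq hr.le]
  have := Real.sqrt_pos.2 hp
  field_simp

/-- The arcsine integral `∫_{|b| < r} (r² - b²)^{-1/2} db = π`, as an upper bound. -/
theorem lintegral_arcsine_le {r : ℝ} (hr : 0 < r) :
    ∫⁻ b in Set.Ioo (-r) r, ENNReal.ofReal ((r ^ 2 - b ^ 2) ^ (-(1 / 2) : ℝ)) ≤
      ENNReal.ofReal Real.pi := by
  have hcont : ContinuousOn (fun b => Real.arcsin (b / r)) (Set.Icc (-r) r) :=
    (Real.continuous_arcsin.comp (continuous_id.div_const r)).continuousOn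
  have hnn : ∀ x ∈ Set.Ioo (-r) r, 0 ≤ (r ^ 2 - x ^ 2) ^ (-(1 / 2) : ℝ) := fun x hx =>
    Real.rpow_nonneg (by nlinarith [hx.1, hx.2]) _
  have hint := intervalIntegral.integrableOn_deriv_of_nonneg hcont
    (fun x hx => hasDerivAt_arcsin_div hr hx) hnn
  have hle : -r ≤ r := by linarith
  have hval := intervalIntegral.integral_eq_sub_of_hasDerivAt_of_le hle hcont
    (fun x hx => hasDerivAt_arcsin_div hr hx)
    ((intervalIntegrable_iff_integrableOn_Ioc_of_le hle).2 hint)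
  rw [← ofReal_integral_eq_lintegral_ofReal (hint.mono_set Set.Ioo_subset_Ioc_self)
    ((ae_restrict_iff' measurableSet_Ioo).2 (ae_of_all _ hnn)), ← integral_Ioc_eq_integral_Ioo,
    ← intervalIntegral.integral_of_le hle, hval, neg_div, div_self hr.ne', Real.arcsin_one,
    Real.arcsin_neg_one]
  exact ENNReal.ofReal_le_ofReal (by linarith)

/-- The cone of positive definite matrices in the coordinates of `symMat`. -/
def posCone : Set (ℝ × ℝ × ℝ) := {v | 0 < v.1 ∧ 0 < v.2.2 ∧ v.2.1 ^ 2 < v.1 * v.2.2}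

theorem isOpen_posCone : IsOpen posCone := by
  have h1 : IsOpen {v : ℝ × ℝ × ℝ | 0 < v.1} := isOpen_lt (by fun_prop) (by fun_prop)
  have h2 : IsOpen {v : ℝ × ℝ × ℝ | 0 < v.2.2} := isOpen_lt (by fun_prop) (by fun_prop)
  have h3 : IsOpen {v : ℝ × ℝ × ℝ | v.2.1 ^ 2 < v.1 * v.2.2} :=
    isOpen_lt (by fun_prop) (by fun_prop)
  exact h1.inter (h2.inter h3)

/-- The function `(1 + v₁₁)⁻² (1 + v₂₂)⁻² det(v)^{-1/2}` on the cone of positive definite matrices,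
extended by zero. It is integrable and dominates the integrand of `h_{k+1,1}`. -/
def coneBound (v : ℝ × ℝ × ℝ) : ℝ :=
  posCone.indicator (fun v => ((1 + v.1) ^ (-2 : ℝ) * (1 + v.2.2) ^ (-2 : ℝ)) *
    (v.1 * v.2.2 - v.2.1 ^ 2) ^ (-(1 / 2) : ℝ)) v

theorem coneBound_nonneg (v : ℝ × ℝ × ℝ) : 0 ≤ coneBound v := by
  refine Set.indicator_nonneg (fun v hv => ?_) v
  obtain ⟨h1, h2, h3⟩ := hv
  have : 0 ≤ v.1 * v.2.2 - v.2.1 ^ 2 := by linarith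
  positivity

theorem measurable_coneBound : Measurable coneBound :=
  Measurable.indicator (by fun_prop) isOpen_posCone.measurableSet

theorem lintegral_one_add_rpow_lt_top :
    ∫⁻ a in Set.Ioi (0 : ℝ), ENNReal.ofReal ((1 + a) ^ (-2 : ℝ)) < ⊤ := by
  have h := integrableOn_add_rpow_Ioi_of_lt (a := -2) (c := 0) (m := 1) (by norm_num) (by norm_num)
  have h2 := h.lintegral_lt_top
  simpa only [add_comm] using h2

theorem integrable_coneBound : Integrable coneBound := by
  refine ⟨measurable_coneBound.aestronglyMeasurable, ?_⟩
  rw [hasFiniteIntegral_iff_ofReal (ae_of_all _ coneBound_nonneg)]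
  have hm : Measurable fun v => ENNReal.ofReal (coneBound v) := measurable_coneBound.ennreal_ofReal
  set f : ℝ → ENNReal :=
    (Set.Ioi (0 : ℝ)).indicator (fun a => ENNReal.ofReal ((1 + a) ^ (-2 : ℝ))) with hf
  have hfm : Measurable f := Measurable.indicator (by fun_prop) measurableSet_Ioi
  have hfi : ∫⁻ a, f a < ⊤ := by
    rw [hf, lintegral_indicator measurableSet_Ioi]
    exact lintegral_one_add_rpow_lt_top
  have inner : ∀ a c : ℝ, ∫⁻ b, ENNReal.ofReal (coneBound (a, b, c)) ≤
      f a * f c * ENNReal.ofReal Real.pi := by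
    intro a c
    by_cases hac : 0 < a ∧ 0 < c
    · obtain ⟨ha, hc⟩ := hac
      -- for fixed diagonal entries `a`, `c` the cone is the interval `|b| < √(ac)`
      have hr : 0 < Real.sqrt (a * c) := Real.sqrt_pos.2 (mul_pos ha hc)
      have hsq : Real.sqrt (a * c) ^ 2 = a * c := Real.sq_sqrt (mul_pos ha hc).le
      have hpt : ∀ b, ENNReal.ofReal (coneBound (a, b, c)) =
          f a * f c * (Set.Ioo (-Real.sqrt (a * c)) (Real.sqrt (a * c))).indicator (fun b =>
            ENNReal.ofReal ((Real.sqrt (a * c) ^ 2 - b ^ 2) ^ (-(1 / 2) : ℝ))) b := by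
        intro b
        have hmem : (a, b, c) ∈ posCone ↔
            b ∈ Set.Ioo (-Real.sqrt (a * c)) (Real.sqrt (a * c)) := by
          rw [Set.mem_Ioo, ← abs_lt, Real.lt_sqrt (abs_nonneg b), sq_abs]
          exact ⟨fun h => h.2.2, fun h => ⟨ha, hc, h⟩⟩
        by_cases hb : (a, b, c) ∈ posCone
        · rw [coneBound, Set.indicator_of_mem hb, Set.indicator_of_mem (hmem.1 hb), hf,
            Set.indicator_of_mem (Set.mem_Ioi.2 ha), Set.indicator_of_mem (Set.mem_Ioi.2 hc), hsq,
            ENNReal.ofReal_mul (by positivity), ENNReal.ofReal_mul (by positivity)]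
        · rw [coneBound, Set.indicator_of_notMem hb,
            Set.indicator_of_notMem (fun h => hb (hmem.2 h))]
          simp
      simp_rw [hpt]
      rw [lintegral_const_mul' _ _ (by simp [hf, ha, hc, ENNReal.mul_eq_top]),
        lintegral_indicator measurableSet_Ioo]
      gcongr
      exact lintegral_arcsine_le hr
    · have : ∀ b, coneBound (a, b, c) = 0 := fun b =>
        Set.indicator_of_notMem (fun h => hac ⟨h.1, h.2.1⟩) _
      simp [this]
  rw [Measure.volume_eq_prod, lintegral_prod _ hm.aemeasurable]
  calc ∫⁻ a, ∫⁻ p : ℝ × ℝ, ENNReal.ofReal (coneBound (a, p))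
      ≤ ∫⁻ a, f a * ((∫⁻ c, f c) * ENNReal.ofReal Real.pi) := by
        refine lintegral_mono fun a => ?_
        have hma : Measurable fun p : ℝ × ℝ => ENNReal.ofReal (coneBound (a, p)) :=
          hm.comp (measurable_const.prodMk measurable_id)
        rw [Measure.volume_eq_prod, lintegral_prod_symm _ hma.aemeasurable]
        refine (lintegral_mono fun c => inner a c).trans ?_
        rw [lintegral_mul_const _ (hfm.const_mul _), lintegral_const_mul _ hfm, mul_assoc]
    _ = (∫⁻ a, f a) * ((∫⁻ c, f c) * ENNReal.ofReal Real.pi) := lintegral_mul_const _ hfm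
    _ < ⊤ := ENNReal.mul_lt_top hfi (ENNReal.mul_lt_top hfi ENNReal.ofReal_lt_top)

/-! ### Bounds for the confluent hypergeometric function -/

theorem exists_one_add_pow_le_exp (m : ℕ) {c : ℝ} (hc : 0 < c) :
    ∃ K : ℝ, 0 < K ∧ ∀ x : ℝ, 0 ≤ x → (1 + x) ^ m ≤ K * Real.exp (c * x) := by
  refine ⟨m.factorial / c ^ m * Real.exp c, by positivity, fun x hx => ?_⟩
  have h := Real.pow_div_factorial_le_exp (c * (1 + x)) (by positivity) m
  have h2 : (0 : ℝ) < m.factorial := by positivity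
  rw [div_le_iff₀ h2, mul_pow] at h
  rw [mul_assoc, ← Real.exp_add, show c + c * x = c * (1 + x) by ring, div_mul_eq_mul_div,
    le_div_iff₀ (by positivity)]
  linarith

/-- The domain of integration of `hFun`. -/
def hDomain (T : Mat2 ℝ) : Set (ℝ × ℝ × ℝ) :=
  {u | (symMat u + T).PosDef ∧ (symMat u - T).PosDef}

/-- The integrand of `hFun`. -/
def hIntegrand (α β : ℝ) (T Y : Mat2 ℝ) (u : ℝ × ℝ × ℝ) : ℝ :=
  (symMat u + T).det ^ (α - 3 / 2) * (symMat u - T).det ^ (β - 3 / 2) *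
    Real.exp (-2 * Real.pi * (Y * symMat u).trace)

theorem hFun_eq (α β : ℝ) (T Y : Mat2 ℝ) :
    hFun α β T Y = ∫ u in hDomain T, hIntegrand α β T Y u := rfl

/-- The upper triangular entries of a matrix, in the order used by `symMat`. -/
def coords (T : Mat2 ℝ) : ℝ × ℝ × ℝ := (T 0 0, T 0 1, T 1 1)

/-- For `T > 0` the condition `U + T > 0` follows from `U - T > 0`. -/
theorem mem_hDomain_iff {T : Mat2 ℝ} (hT : T.PosDef) (u : ℝ × ℝ × ℝ) :
    u ∈ hDomain T ↔ u - coords T ∈ posCone := by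
  have hs := (posDef_fin_two_iff.1 hT).1
  have key : (symMat u - T).PosDef ↔ u - coords T ∈ posCone := by
    rw [posDef_fin_two_iff]
    simp [symMat, posCone, coords, hs]
  refine ⟨fun h => key.1 h.2, fun h => ⟨?_, key.2 h⟩⟩
  have := (key.2 h).add (hT.add hT)
  rwa [show symMat u - T + (T + T) = symMat u + T by abel] at this

theorem isOpen_hDomain {T : Mat2 ℝ} (hT : T.PosDef) : IsOpen (hDomain T) := by
  have : hDomain T = (fun u => u - coords T) ⁻¹' posCone := by
    ext u
    exact mem_hDomain_iff hT u
  rw [this]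
  exact isOpen_posCone.preimage (by fun_prop)

theorem hDomain_nonempty {T : Mat2 ℝ} (hT : T.PosDef) : (hDomain T).Nonempty :=
  ⟨(1, 0, 1) + coords T, (mem_hDomain_iff hT _).2 (by simp [posCone])⟩

theorem hIntegrand_pos (α β : ℝ) {T Y : Mat2 ℝ} {u : ℝ × ℝ × ℝ} (hu : u ∈ hDomain T) :
    0 < hIntegrand α β T Y u :=
  mul_pos (mul_pos (Real.rpow_pos_of_pos hu.1.det_pos _) (Real.rpow_pos_of_pos hu.2.det_pos _))
    (Real.exp_pos _)

theorem measurable_hIntegrand (α β : ℝ) (T Y : Mat2 ℝ) : Measurable (hIntegrand α β T Y) := by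
  unfold hIntegrand
  simp only [symMat, det_fin_two, trace_fin_two, Matrix.mul_apply, Fin.sum_univ_two,
    Matrix.add_apply, Matrix.sub_apply, Matrix.of_apply, Matrix.cons_val', Matrix.cons_val_zero,
    Matrix.cons_val_one, Matrix.cons_val_fin_one]
  fun_prop

/-- `tr(YV) ≥ (det Y / tr Y) tr V` for `V > 0`. -/
theorem det_div_trace_mul_trace_le {Y V : Mat2 ℝ} (hYs : Y 1 0 = Y 0 1) (hY : 0 < Y.trace)
    (hV : V.PosDef) : Y.det / Y.trace * V.trace ≤ (Y * V).trace := by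
  obtain ⟨hs, h0, h1, hd⟩ := posDef_fin_two_iff.1 hV
  rw [trace_fin_two] at hY
  have := det_div_trace_mul_le (q := Y 0 1) hY h0.le h1.le hd.le
  simp only [trace_fin_two, det_fin_two, Matrix.mul_apply, Fin.sum_univ_two, hYs, hs]
  rw [← sq]
  linarith

/-- Exponential decay at rate `μ` absorbs powers of `1 + a + c`, at the cost of powers of
`1 + μ⁻¹`. -/
theorem exists_pow_mul_exp_le (n : ℕ) :
    ∃ C : ℝ, 0 < C ∧ ∀ a c μ : ℝ, 0 < a → 0 < c → 0 < μ →
      (1 + (a + c)) ^ n * Real.exp (-(2 * Real.pi * (μ * (a + c)))) ≤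
        C * (1 + μ⁻¹) ^ (n + 4) * ((1 + a) ^ (-2 : ℝ) * (1 + c) ^ (-2 : ℝ)) := by
  obtain ⟨C, hC, hexp⟩ := exists_one_add_pow_le_exp (n + 4) Real.two_pi_pos
  refine ⟨C, hC, fun a c μ ha hc hμ => ?_⟩
  have p1 : 0 < 1 + a := by linarith
  have p2 : 0 < 1 + c := by linarith
  rw [Real.rpow_neg p1.le, Real.rpow_neg p2.le, Real.rpow_two, Real.rpow_two, ← mul_inv,
    ← div_eq_mul_inv, le_div_iff₀ (by positivity)]
  have g3 := hexp (μ * (a + c)) (by positivity)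
  generalize hE : Real.exp (2 * Real.pi * (μ * (a + c))) = E at g3
  have hE0 : 0 < E := hE ▸ Real.exp_pos _
  rw [Real.exp_neg, hE, mul_assoc, ← div_eq_inv_mul, ← mul_div_assoc, div_le_iff₀ hE0]
  have g2 : (1 + (a + c)) ≤ (1 + μ⁻¹) * (1 + μ * (a + c)) := by
    have : μ⁻¹ * μ = 1 := inv_mul_cancel₀ hμ.ne'
    have h5 : 0 < μ⁻¹ := by positivity
    have h6 : 0 < μ * (a + c) := by positivity
    calc 1 + (a + c) ≤ 1 + μ⁻¹ + μ * (a + c) + (μ⁻¹ * μ) * (a + c) := by rw [this]; linarith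
      _ = _ := by ring
  have f4 : (1 + a) ^ 2 * (1 + c) ^ 2 ≤ (1 + (a + c)) ^ 4 := by
    have e1 : (1 + a) ^ 2 ≤ (1 + (a + c)) ^ 2 := by gcongr; linarith
    have e2 : (1 + c) ^ 2 ≤ (1 + (a + c)) ^ 2 := by gcongr; linarith
    calc _ ≤ (1 + (a + c)) ^ 2 * (1 + (a + c)) ^ 2 := by gcongr
      _ = _ := by ring
  calc (1 + (a + c)) ^ n * ((1 + a) ^ 2 * (1 + c) ^ 2)
      ≤ (1 + (a + c)) ^ n * (1 + (a + c)) ^ 4 := by gcongr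
    _ = (1 + (a + c)) ^ (n + 4) := by ring
    _ ≤ ((1 + μ⁻¹) * (1 + μ * (a + c))) ^ (n + 4) := by gcongr
    _ = (1 + μ⁻¹) ^ (n + 4) * (1 + μ * (a + c)) ^ (n + 4) := mul_pow _ _ _
    _ ≤ (1 + μ⁻¹) ^ (n + 4) * (C * E) := by gcongr
    _ = _ := by ring

theorem det_add_le_sq {a b c p q r : ℝ} (ha : 0 < a) (hc : 0 < c) (hp : 0 < p) (hr : 0 < r) :
    (a + p + p) * (c + r + r) - (b + q + q) * (b + q + q) ≤
      ((1 + 2 * (p + r)) * (1 + (a + c))) ^ 2 := by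
  have e0 : 0 < (p + r) * (a + c) := by positivity
  have e1 : a + p + p ≤ (1 + 2 * (p + r)) * (1 + (a + c)) := by nlinarith
  have e2 : c + r + r ≤ (1 + 2 * (p + r)) * (1 + (a + c)) := by nlinarith
  have e3 := mul_le_mul e1 e2 (by positivity) (by positivity)
  nlinarith [mul_self_nonneg (b + q + q)]

/-- The integrand of `h_{k+1,1}(T;Y)` is dominated by a translate of `coneBound`, with a
constant that is polynomial in `tr Y / det Y`. -/
theorem exists_hIntegrand_le (k : ℕ) (hk : 0 < k) {T : Mat2 ℝ} (hT : T.PosDef) :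
    ∃ K : ℝ, 0 < K ∧ ∀ Y : Mat2 ℝ, Y 1 0 = Y 0 1 → 0 < Y.trace → 0 < Y.det →
      ∀ u ∈ hDomain T, hIntegrand (k + 1) 1 T Y u ≤
        K * (1 + Y.trace / Y.det) ^ (2 * k + 4) * coneBound (u - coords T) := by
  obtain ⟨C, hC, hexp⟩ := exists_pow_mul_exp_le (2 * k)
  have htrT : 0 < T.trace := hT.trace_pos
  refine ⟨(1 + 2 * T.trace) ^ (2 * k) * C, by positivity, fun Y hYs hY hYd u hu => ?_⟩
  have hv := (mem_hDomain_iff hT u).1 hu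
  obtain ⟨hTs, hT0, hT1, -⟩ := posDef_fin_two_iff.1 hT
  have hUT := hu.2
  have hUTdet := hu.1.det_pos
  have hk1 : (1 : ℝ) ≤ k := by exact_mod_cast hk
  have hmu : 0 < Y.det / Y.trace := div_pos hYd hY
  have htr : Y.det / Y.trace * (symMat u - T).trace ≤ (Y * symMat u).trace := by
    -- `tr(YU) = tr(YV) + tr(YT)` with `V = U - T`, and `tr(YT)` is positive
    have h1 := det_div_trace_mul_trace_le hYs hY hUT
    have h2 := det_div_trace_mul_trace_le hYs hY hT
    have h3 : 0 ≤ Y.det / Y.trace * T.trace := by positivity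
    rw [Matrix.mul_sub, trace_sub (Y * _)] at h1
    linarith
  rw [coneBound, Set.indicator_of_mem hv]
  obtain ⟨hv0, hv1, -⟩ := hv
  obtain ⟨a, b, c, habc⟩ : ∃ a b c, u - coords T = (a, b, c) := ⟨_, _, _, rfl⟩
  rw [habc] at hv0 hv1 ⊢
  simp only at hv0 hv1 ⊢
  have hu0 : u.1 = a + T 0 0 := by rw [← sub_eq_iff_eq_add]; exact congrArg (·.1) habc
  have hu1 : u.2.1 = b + T 0 1 := by rw [← sub_eq_iff_eq_add]; exact congrArg (·.2.1) habc
  have hu2 : u.2.2 = c + T 1 1 := by rw [← sub_eq_iff_eq_add]; exact congrArg (·.2.2) habc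
  have htau : (symMat u - T).trace = a + c := by
    rw [trace_sub, trace_fin_two, trace_fin_two]
    simp only [symMat, Matrix.of_apply, Matrix.cons_val',
      Matrix.cons_val_zero, Matrix.cons_val_one, Matrix.cons_val_fin_one, hu0, hu2]
    ring
  have hdetm : (symMat u - T).det = a * c - b ^ 2 := by
    simp only [symMat, det_fin_two, Matrix.sub_apply, Matrix.of_apply, Matrix.cons_val',
      Matrix.cons_val_zero, Matrix.cons_val_one, Matrix.cons_val_fin_one, hTs, hu0, hu1, hu2]
    ring
  have hdetp : (symMat u + T).det ≤ ((1 + 2 * T.trace) * (1 + (a + c))) ^ 2 := by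
    simp only [symMat, det_fin_two, Matrix.add_apply, Matrix.of_apply, Matrix.cons_val',
      Matrix.cons_val_zero, Matrix.cons_val_one, Matrix.cons_val_fin_one, hTs, hu0, hu1, hu2]
    rw [trace_fin_two]
    exact det_add_le_sq hv0 hv1 hT0 hT1
  have f1 : (symMat u + T).det ^ ((k : ℝ) + 1 - 3 / 2) ≤
      (1 + 2 * T.trace) ^ (2 * k) * (1 + (a + c)) ^ (2 * k) := by
    have hQ : 1 ≤ ((1 + 2 * T.trace) * (1 + (a + c))) ^ 2 :=
      one_le_pow₀ (one_le_mul_of_one_le_of_one_le (by linarith) (by linarith))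
    calc (symMat u + T).det ^ ((k : ℝ) + 1 - 3 / 2)
        ≤ (((1 + 2 * T.trace) * (1 + (a + c))) ^ 2) ^ ((k : ℝ) + 1 - 3 / 2) :=
          Real.rpow_le_rpow hUTdet.le hdetp (by linarith)
      _ ≤ (((1 + 2 * T.trace) * (1 + (a + c))) ^ 2) ^ (k : ℝ) :=
          Real.rpow_le_rpow_of_exponent_le hQ (by linarith)
      _ = _ := by rw [Real.rpow_natCast, ← pow_mul, mul_pow]
  have f2 : (symMat u - T).det ^ ((1 : ℝ) - 3 / 2) = (a * c - b ^ 2) ^ (-(1 / 2) : ℝ) := by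
    rw [hdetm]; norm_num
  have f2' : 0 ≤ (a * c - b ^ 2) ^ (-(1 / 2) : ℝ) :=
    Real.rpow_nonneg (hdetm ▸ hUT.det_pos.le) _
  have f3 : Real.exp (-2 * Real.pi * (Y * symMat u).trace) ≤
      Real.exp (-(2 * Real.pi * (Y.det / Y.trace * (a + c)))) := by
    rw [Real.exp_le_exp, ← htau]
    nlinarith [Real.pi_pos]
  have f4 := hexp a c _ hv0 hv1 hmu
  rw [inv_div] at f4
  rw [hIntegrand, f2]
  have hE0 := (Real.exp_pos (-2 * Real.pi * (Y * symMat u).trace)).le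
  generalize Real.exp (-2 * Real.pi * (Y * symMat u).trace) = E at f3 hE0
  generalize Real.exp (-(2 * Real.pi * (Y.det / Y.trace * (a + c)))) = E' at f3 f4
  generalize (a * c - b ^ 2) ^ (-(1 / 2) : ℝ) = R at f2'
  generalize (1 + a) ^ (-2 : ℝ) * (1 + c) ^ (-2 : ℝ) = G at f4
  have ht2 : 0 ≤ (1 + 2 * T.trace) ^ (2 * k) := by positivity
  have ht3 : 0 ≤ (1 + (a + c)) ^ (2 * k) := by positivity
  calc _ ≤ (1 + 2 * T.trace) ^ (2 * k) * (1 + (a + c)) ^ (2 * k) * R * E' := by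
        have := mul_nonneg (mul_nonneg ht2 ht3) f2'
        gcongr
    _ = (1 + 2 * T.trace) ^ (2 * k) * ((1 + (a + c)) ^ (2 * k) * E') * R := by ring
    _ ≤ (1 + 2 * T.trace) ^ (2 * k) * (C * (1 + Y.trace / Y.det) ^ (2 * k + 4) * G) * R := by
        gcongr
    _ = _ := by ring

theorem integrable_coneBound_sub (t : ℝ × ℝ × ℝ) : Integrable fun u => coneBound (u - t) := by
  have : (volume : Measure (ℝ × ℝ × ℝ)).IsAddRightInvariant :=
    Measure.prod.instIsAddRightInvariant
  exact integrable_coneBound.comp_sub_right t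

theorem integrableOn_hIntegrand (k : ℕ) (hk : 0 < k) {T Y : Mat2 ℝ} (hT : T.PosDef)
    (hYs : Y 1 0 = Y 0 1) (hY : 0 < Y.trace) (hYd : 0 < Y.det) :
    IntegrableOn (hIntegrand (k + 1) 1 T Y) (hDomain T) := by
  obtain ⟨K, -, hle⟩ := exists_hIntegrand_le k hk hT
  refine Integrable.mono' (g := fun u =>
    K * (1 + Y.trace / Y.det) ^ (2 * k + 4) * coneBound (u - coords T))
    ((integrable_coneBound_sub _).const_mul _).integrableOn
    (measurable_hIntegrand _ _ _ _).aestronglyMeasurable ?_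
  refine (ae_restrict_iff' (isOpen_hDomain hT).measurableSet).2 (ae_of_all _ fun u hu => ?_)
  rw [Real.norm_of_nonneg (hIntegrand_pos _ _ hu).le]
  exact hle Y hYs hY hYd u hu

theorem hFun_pos (k : ℕ) (hk : 0 < k) {T Y : Mat2 ℝ} (hT : T.PosDef)
    (hYs : Y 1 0 = Y 0 1) (hY : 0 < Y.trace) (hYd : 0 < Y.det) : 0 < hFun (k + 1) 1 T Y := by
  have hm := (isOpen_hDomain hT).measurableSet
  rw [hFun_eq, setIntegral_pos_iff_support_of_nonneg_ae
    ((ae_restrict_iff' hm).2 (ae_of_all _ fun u hu => (hIntegrand_pos _ _ hu).le))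
    (integrableOn_hIntegrand k hk hT hYs hY hYd)]
  refine ((isOpen_hDomain hT).measure_pos volume (hDomain_nonempty hT)).trans_le
    (measure_mono fun u hu => ⟨(hIntegrand_pos _ _ hu).ne', hu⟩)

theorem exists_hFun_le (k : ℕ) (hk : 0 < k) {T : Mat2 ℝ} (hT : T.PosDef) :
    ∃ K : ℝ, 0 < K ∧ ∀ Y : Mat2 ℝ, Y 1 0 = Y 0 1 → 0 < Y.trace → 0 < Y.det →
      hFun (k + 1) 1 T Y ≤ K * (1 + Y.trace / Y.det) ^ (2 * k + 4) := by
  obtain ⟨K, hK, hle⟩ := exists_hIntegrand_le k hk hT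
  have hI : 0 ≤ ∫ u, coneBound (u - coords T) := integral_nonneg fun u => coneBound_nonneg _
  refine ⟨K * (1 + ∫ u, coneBound (u - coords T)), by positivity, fun Y hYs hY hYd => ?_⟩
  have hg := (integrable_coneBound_sub (coords T)).const_mul
    (K * (1 + Y.trace / Y.det) ^ (2 * k + 4))
  have hpos : 0 < Y.trace / Y.det := by positivity
  calc hFun (k + 1) 1 T Y
      ≤ ∫ u in hDomain T, K * (1 + Y.trace / Y.det) ^ (2 * k + 4) * coneBound (u - coords T) :=
        setIntegral_mono_on (integrableOn_hIntegrand k hk hT hYs hY hYd) hg.integrableOn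
          (isOpen_hDomain hT).measurableSet (hle Y hYs hY hYd)
    _ ≤ ∫ u, K * (1 + Y.trace / Y.det) ^ (2 * k + 4) * coneBound (u - coords T) :=
        setIntegral_le_integral hg (ae_of_all _ fun u =>
          mul_nonneg (by positivity) (coneBound_nonneg _))
    _ = K * (1 + Y.trace / Y.det) ^ (2 * k + 4) * ∫ u, coneBound (u - coords T) :=
        integral_const_mul _ _
    _ ≤ K * (1 + Y.trace / Y.det) ^ (2 * k + 4) * (1 + ∫ u, coneBound (u - coords T)) := by
        gcongr; linarith
    _ = K * (1 + ∫ u, coneBound (u - coords T)) * (1 + Y.trace / Y.det) ^ (2 * k + 4) := by ring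

/-- The seed decays exponentially in `tr Y` and is otherwise polynomial in `tr Y`, `det Y` and
`1 / det Y`. -/
theorem exists_norm_seed_le (k : ℕ) (hk : 0 < k) {T T' : Mat2 ℝ} (hT : T.PosDef)
    (hT' : T'.PosDef) :
    ∃ K c : ℝ, 0 < K ∧ 0 < c ∧ ∀ Z : Mat2 ℂ, imMat Z 1 0 = imMat Z 0 1 → 0 < (imMat Z).trace →
      0 < (imMat Z).det → ‖seed k T T' Z‖ ≤ K * (imMat Z).det *
        (1 + (imMat Z).trace / (imMat Z).det) ^ (2 * k + 4) *
          Real.exp (-(c * (imMat Z).trace)) := by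
  obtain ⟨K, hK, hle⟩ := exists_hFun_le k hk hT
  have hTd := hT.det_pos
  have hTd' := hT'.det_pos
  have hTt' : 0 < T'.trace := hT'.trace_pos
  refine ⟨T.det * K, 2 * Real.pi * (T'.det / T'.trace), by positivity, by positivity,
    fun Z hZs hZ hZd => ?_⟩
  have hh := hFun_pos k hk hT hZs hZ hZd
  have hpsi : ‖Psi k T Z‖ = T.det * (imMat Z).det * hFun (k + 1) 1 T (imMat Z) := by
    rw [Psi, norm_mul, Complex.norm_real, Real.norm_of_nonneg, Complex.norm_exp, det_mul]
    · simp
    · rw [det_mul]; positivity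
  have hphi : ‖Phi T' Z‖ = Real.exp (-(2 * Real.pi * (T' * imMat Z).trace)) := by
    rw [Phi, Complex.norm_exp]
    congr 1
    simp [toC, imMat, trace_fin_two, Matrix.mul_apply, Fin.sum_univ_two, Complex.mul_re]
  have hYpd : (imMat Z).PosDef := by
    have hdet := hZd
    rw [det_fin_two, hZs] at hdet
    rw [trace_fin_two] at hZ
    have hmul : 0 < imMat Z 0 0 * imMat Z 1 1 := by nlinarith [sq_nonneg (imMat Z 0 1)]
    have h00 : 0 < imMat Z 0 0 := by
      by_contra! h
      nlinarith
    exact posDef_fin_two_iff.2 ⟨hZs, h00, pos_of_mul_pos_right hmul h00.le, by linarith⟩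
  have htr := det_div_trace_mul_trace_le (posDef_fin_two_iff.1 hT').1 hTt' hYpd
  rw [seed, norm_mul, hpsi, hphi]
  have h1 := hle _ hZs hZ hZd
  have h2 : Real.exp (-(2 * Real.pi * (T' * imMat Z).trace)) ≤
      Real.exp (-(2 * Real.pi * (T'.det / T'.trace) * (imMat Z).trace)) := by
    rw [Real.exp_le_exp]
    nlinarith [Real.pi_pos]
  calc _ ≤ T.det * (imMat Z).det * (K * (1 + (imMat Z).trace / (imMat Z).det) ^ (2 * k + 4)) *
        Real.exp (-(2 * Real.pi * (T'.det / T'.trace) * (imMat Z).trace)) := by gcongr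
    _ = _ := by ring

/-! ### The symplectic action -/

theorem intToC_transpose (B : Mat2 ℤ) : intToC Bᵀ = (intToC B)ᵀ := rfl

theorem intToC_one : intToC 1 = 1 := by
  ext i j
  fin_cases i <;> fin_cases j <;> simp [intToC]

theorem intToC_sub (P Q : Mat2 ℤ) : intToC (P - Q) = intToC P - intToC Q := by
  ext i j
  simp [intToC]

theorem intToC_conjTranspose (B : Mat2 ℤ) : (intToC B)ᴴ = (intToC B)ᵀ := by
  ext i j
  simp [intToC]

/-- The relations between the columns of a symplectic matrix. -/
theorem block_relations (M : Gam) :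
    (blockA M)ᵀ * blockC M = (blockC M)ᵀ * blockA M ∧
      (blockB M)ᵀ * blockD M = (blockD M)ᵀ * blockB M ∧
        (blockA M)ᵀ * blockD M - (blockC M)ᵀ * blockB M = 1 := by
  have h := M.2
  rw [← fromBlocks_toBlocks (M : Matrix (Fin 2 ⊕ Fin 2) (Fin 2 ⊕ Fin 2) ℤ),
    SymplecticGroup.fromBlocks_mem_iff] at h
  obtain ⟨h1, h2, h3⟩ := h
  refine ⟨?_, ?_, ?_⟩
  · simpa only [intToC_mul, intToC_transpose, blockA, blockB, blockC, blockD] using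
      congrArg intToC h1
  · simpa only [intToC_mul, intToC_transpose, blockA, blockB, blockC, blockD] using
      congrArg intToC h2
  · simpa only [intToC_mul, intToC_transpose, intToC_sub, intToC_one, blockA, blockB,
      blockC, blockD] using congrArg intToC h3

theorem block_relation_one_transpose (M : Gam) :
    (blockD M)ᵀ * blockA M - (blockB M)ᵀ * blockC M = 1 := by
  have := congrArg Matrix.transpose (block_relations M).2.2
  simpa using this

theorem num_transpose_mul_denom (M : Gam) {Z : Mat2 ℂ} (hZ : Z.IsSymm) :
    (blockA M * Z + blockB M)ᵀ * denom M Z = (denom M Z)ᵀ * (blockA M * Z + blockB M) := by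
  obtain ⟨h1, h2, h3⟩ := block_relations M
  have h4 := block_relation_one_transpose M
  rw [← sub_eq_zero, denom]
  simp only [transpose_add, transpose_mul, hZ.eq]
  calc _ = Z * ((blockA M)ᵀ * blockC M - (blockC M)ᵀ * blockA M) * Z +
        Z * ((blockA M)ᵀ * blockD M - (blockC M)ᵀ * blockB M) -
        ((blockD M)ᵀ * blockA M - (blockB M)ᵀ * blockC M) * Z +
        ((blockB M)ᵀ * blockD M - (blockD M)ᵀ * blockB M) := by noncomm_ring
    _ = 0 := by rw [h3, h4, h1, h2]; simp

theorem num_conjTranspose_mul_denom (M : Gam) (Z : Mat2 ℂ) :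
    (blockA M * Z + blockB M)ᴴ * denom M Z - (denom M Z)ᴴ * (blockA M * Z + blockB M) =
      Zᴴ - Z := by
  obtain ⟨h1, h2, h3⟩ := block_relations M
  have h4 := block_relation_one_transpose M
  have hA : (blockA M)ᴴ = (blockA M)ᵀ := intToC_conjTranspose _
  have hB : (blockB M)ᴴ = (blockB M)ᵀ := intToC_conjTranspose _
  have hC : (blockC M)ᴴ = (blockC M)ᵀ := intToC_conjTranspose _
  have hD : (blockD M)ᴴ = (blockD M)ᵀ := intToC_conjTranspose _
  rw [denom]
  simp only [conjTranspose_add, conjTranspose_mul, hA, hB, hC, hD]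
  calc _ = Zᴴ * ((blockA M)ᵀ * blockC M - (blockC M)ᵀ * blockA M) * Z +
        Zᴴ * ((blockA M)ᵀ * blockD M - (blockC M)ᵀ * blockB M) -
        ((blockD M)ᵀ * blockA M - (blockB M)ᵀ * blockC M) * Z +
        ((blockB M)ᵀ * blockD M - (blockD M)ᵀ * blockB M) := by noncomm_ring
    _ = _ := by rw [h3, h4, h1, h2]; simp

theorem act_isSymm (M : Gam) {Z : Mat2 ℂ} (hZ : Z.IsSymm) (hd : (denom M Z).det ≠ 0) :
    (act M Z).IsSymm := by
  have hu : IsUnit (denom M Z).det := hd.isUnit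
  have hut : IsUnit (denom M Z)ᵀ.det := by rwa [det_transpose]
  have h := num_transpose_mul_denom M hZ
  rw [Matrix.IsSymm, act, transpose_mul, transpose_nonsing_inv]
  have h2 : (blockA M * Z + blockB M)ᵀ =
      (denom M Z)ᵀ * (blockA M * Z + blockB M) * (denom M Z)⁻¹ := by
    rw [← h, Matrix.mul_assoc, mul_nonsing_inv _ hu, Matrix.mul_one]
  rw [h2, Matrix.mul_assoc, nonsing_inv_mul_cancel_left _ _ hut]

theorem conjTranspose_sub_self {Z : Mat2 ℂ} (hZ : Z.IsSymm) :
    Zᴴ - Z = (-2 * Complex.I) • toC (imMat Z) := by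
  ext i j
  have := hZ.apply i j
  simp only [Matrix.sub_apply, conjTranspose_apply, this, Matrix.smul_apply, toC, imMat,
    Matrix.map_apply, smul_eq_mul]
  apply Complex.ext <;> simp
  ring

/-- `Im(M • Z) = (CZ+D)^{-*} Im(Z) (CZ+D)^{-1}`. -/
theorem toC_imMat_act (M : Gam) {Z : Mat2 ℂ} (hZ : Z.IsSymm) (hd : (denom M Z).det ≠ 0) :
    toC (imMat (act M Z)) = ((denom M Z)⁻¹)ᴴ * toC (imMat Z) * (denom M Z)⁻¹ := by
  have hu : IsUnit (denom M Z).det := hd.isUnit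
  have huh : IsUnit (denom M Z)ᴴ.det := by
    rw [det_conjTranspose]; exact (star_ne_zero.2 hd).isUnit
  have h1 := conjTranspose_sub_self (act_isSymm M hZ hd)
  have h2 : (act M Z)ᴴ - act M Z = ((denom M Z)⁻¹)ᴴ * (Zᴴ - Z) * (denom M Z)⁻¹ := by
    rw [← num_conjTranspose_mul_denom M Z, act, conjTranspose_mul, Matrix.mul_sub, Matrix.sub_mul,
      conjTranspose_nonsing_inv, ← Matrix.mul_assoc, ← Matrix.mul_assoc,
      mul_nonsing_inv_cancel_right _ _ hu, nonsing_inv_mul _ huh, Matrix.one_mul]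
  rw [h1, conjTranspose_sub_self hZ, Matrix.mul_smul, Matrix.smul_mul] at h2
  exact smul_right_injective _ (by simp : (-2 * Complex.I) ≠ 0) h2

theorem det_toC (Y : Mat2 ℝ) : (toC Y).det = (Y.det : ℂ) := by
  simp [toC, det_fin_two]

theorem det_imMat_act (M : Gam) {Z : Mat2 ℂ} (hZ : Z.IsSymm) (hd : (denom M Z).det ≠ 0) :
    (imMat (act M Z)).det = (imMat Z).det / ‖(denom M Z).det‖ ^ 2 := by
  have h := congrArg Matrix.det (toC_imMat_act M hZ hd)
  rw [det_mul, det_mul, det_conjTranspose, det_nonsing_inv, det_toC, det_toC, Ring.inverse_eq_inv',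
    mul_right_comm, ← starRingEnd_apply, ← Complex.normSq_eq_conj_mul_self,
    Complex.normSq_eq_norm_sq, norm_inv] at h
  rw [div_eq_inv_mul, ← inv_pow]
  exact_mod_cast h

/-- The squared Frobenius norm. -/
def sqNorm (W : Mat2 ℂ) : ℝ := ∑ i, ∑ j, Complex.normSq (W i j)

theorem sqNorm_eq (W : Mat2 ℂ) : sqNorm W = Complex.normSq (W 0 0) + Complex.normSq (W 0 1) +
    (Complex.normSq (W 1 0) + Complex.normSq (W 1 1)) := by
  simp [sqNorm, Fin.sum_univ_two]

/-- `tr(G* Y G) ≥ (det Y / tr Y) |G|²`: the quadratic form bound for the two columns of `G`. -/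
theorem le_trace_congr (G : Mat2 ℂ) {Y : Mat2 ℝ} (hYs : Y 1 0 = Y 0 1) (hY : 0 < Y.trace) :
    Y.det / Y.trace * sqNorm G ≤ (Gᴴ * toC Y * G).trace.re := by
  rw [trace_fin_two] at hY
  have key : ∀ p q : ℂ, Y.det / Y.trace * (Complex.normSq p + Complex.normSq q) ≤
      Y 0 0 * Complex.normSq p + 2 * Y 0 1 * (p.re * q.re + p.im * q.im) +
        Y 1 1 * Complex.normSq q := by
    intro p q
    rw [det_fin_two, trace_fin_two, hYs, ← sq]
    refine det_div_trace_mul_le hY (Complex.normSq_nonneg _) (Complex.normSq_nonneg _) ?_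
    simp only [Complex.normSq_apply]
    nlinarith [sq_nonneg (p.re * q.im - p.im * q.re)]
  have h0 := key (G 0 0) (G 1 0)
  have h1 := key (G 0 1) (G 1 1)
  have e : (Gᴴ * toC Y * G).trace.re =
      (Y 0 0 * Complex.normSq (G 0 0) + 2 * Y 0 1 * ((G 0 0).re * (G 1 0).re +
        (G 0 0).im * (G 1 0).im) + Y 1 1 * Complex.normSq (G 1 0)) +
      (Y 0 0 * Complex.normSq (G 0 1) + 2 * Y 0 1 * ((G 0 1).re * (G 1 1).re +
        (G 0 1).im * (G 1 1).im) + Y 1 1 * Complex.normSq (G 1 1)) := by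
    simp [trace_fin_two, Matrix.mul_apply, Fin.sum_univ_two, toC, hYs, Complex.normSq_apply]
    ring
  rw [e, sqNorm_eq]
  linarith

/-- A `2 × 2` matrix and its adjugate have the same Frobenius norm. -/
theorem sqNorm_inv (W : Mat2 ℂ) : sqNorm W⁻¹ = sqNorm W / ‖W.det‖ ^ 2 := by
  rw [Matrix.inv_def, Ring.inverse_eq_inv', adjugate_fin_two, sqNorm_eq, sqNorm_eq,
    ← Complex.normSq_eq_norm_sq]
  simp
  ring

theorem le_trace_imMat_act (M : Gam) {Z : Mat2 ℂ} (hZ : Z ∈ upperHalfSpace)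
    (hd : (denom M Z).det ≠ 0) :
    (imMat Z).det / (imMat Z).trace * (sqNorm (denom M Z) / ‖(denom M Z).det‖ ^ 2) ≤
      (imMat (act M Z)).trace := by
  have h := le_trace_congr (denom M Z)⁻¹ (posDef_fin_two_iff.1 hZ.2).1 hZ.2.trace_pos
  rw [← toC_imMat_act M hZ.1 hd, sqNorm_inv] at h
  refine h.trans_eq ?_
  simp [toC, trace_fin_two]

theorem two_mul_norm_det_le (W : Mat2 ℂ) : 2 * ‖W.det‖ ≤ sqNorm W := by
  rw [det_fin_two, sqNorm_eq]
  simp only [Complex.normSq_eq_norm_sq]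
  have h := norm_sub_le (W 0 0 * W 1 1) (W 0 1 * W 1 0)
  rw [norm_mul, norm_mul] at h
  nlinarith [sq_nonneg (‖W 0 0‖ - ‖W 1 1‖), sq_nonneg (‖W 0 1‖ - ‖W 1 0‖)]

/-! ### Estimate of a single term -/

/-- Exponential decay in `t ≥ λ S / d²` turns the bound for the seed into a negative power of `S`:
for `d ≥ 1` powers of `d` are absorbed by `d⁻ʷ`, and for `d ≤ 1` the factor `d⁻ʷ` is absorbed
because `t ≥ 2λ / d`. -/
theorem exists_term_le {K c δ lam : ℝ} (hK : 0 < K) (hc : 0 < c) (hδ : 0 < δ) (hl : 0 < lam)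
    {m n w : ℕ} (hw : 2 * m + 2 * n ≤ w) :
    ∃ K' : ℝ, 0 < K' ∧ ∀ d S t : ℝ, 0 < d → 2 * d ≤ S → lam * (S / d ^ 2) ≤ t →
      (d ^ w)⁻¹ * (K * (δ / d ^ 2) * (1 + t / (δ / d ^ 2)) ^ m * Real.exp (-(c * t))) ≤
        K' * (S ^ n)⁻¹ := by
  obtain ⟨C, hC, hexp⟩ := exists_one_add_pow_le_exp (m + n + (w + 2)) hc
  set K₀ := K * δ * (1 + δ⁻¹) ^ m * (lam ^ n)⁻¹ * C with hK₀
  have hK₀pos : 0 < K₀ := by positivity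
  refine ⟨K₀ * (1 + ((2 * lam) ^ (w + 2))⁻¹), by positivity, fun d S t hd hSd hSt => ?_⟩
  have hS : 0 < S := by linarith
  have ht : 0 < t := lt_of_lt_of_le (by positivity) hSt
  have he := hexp t ht.le
  generalize hE : Real.exp (c * t) = E at he
  have hE0 : 0 < E := hE ▸ Real.exp_pos _
  have hS1 : lam * S ≤ (1 + t) * d ^ 2 := by
    rw [← mul_div_assoc, div_le_iff₀ (by positivity)] at hSt
    nlinarith [sq_nonneg d]
  have hd1 : 2 * lam ≤ (1 + t) * d := by
    have : 2 * lam * d ≤ (1 + t) * d * d := by nlinarith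
    exact le_of_mul_le_mul_right this hd
  -- the claim with all denominators cleared
  suffices h : K * δ * (1 + t * d ^ 2 / δ) ^ m * S ^ n ≤
      K₀ * (1 + ((2 * lam) ^ (w + 2))⁻¹) * d ^ (w + 2) * E by
    rw [Real.exp_neg, hE, div_div_eq_mul_div, ← div_eq_inv_mul, div_le_iff₀ (by positivity),
      ← div_eq_mul_inv, div_le_iff₀ hE0, ← div_eq_mul_inv, div_mul_eq_mul_div,
      div_mul_eq_mul_div, le_div_iff₀ (by positivity)]
    calc K * (δ / d ^ 2) * (1 + t * d ^ 2 / δ) ^ m * S ^ n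
        = K * δ * (1 + t * d ^ 2 / δ) ^ m * S ^ n / d ^ 2 := by ring
      _ ≤ K₀ * (1 + ((2 * lam) ^ (w + 2))⁻¹) * d ^ (w + 2) * E / d ^ 2 := by gcongr
      _ = _ := by
          rw [show d ^ (w + 2) = d ^ 2 * d ^ w by ring]
          field_simp
  have hSn : S ^ n ≤ (lam ^ n)⁻¹ * ((1 + t) ^ n * d ^ (2 * n)) := by
    rw [← div_eq_inv_mul, le_div_iff₀ (by positivity), ← mul_pow, pow_mul, ← mul_pow, mul_comm S]
    gcongr
  have h1t : 1 ≤ 1 + t := by linarith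
  rcases le_total 1 d with h | h
  · have h1 : 1 + t * d ^ 2 / δ ≤ (1 + δ⁻¹) * (1 + t) * d ^ 2 := by
      have hd2 : 1 ≤ d ^ 2 := one_le_pow₀ h
      have : 0 < δ⁻¹ := by positivity
      have h3 : 0 ≤ t * d ^ 2 := by positivity
      rw [div_eq_mul_inv]
      nlinarith [mul_pos this (by positivity : 0 < d ^ 2)]
    calc K * δ * (1 + t * d ^ 2 / δ) ^ m * S ^ n
        ≤ K * δ * ((1 + δ⁻¹) * (1 + t) * d ^ 2) ^ m *
          ((lam ^ n)⁻¹ * ((1 + t) ^ n * d ^ (2 * n))) := by gcongr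
      _ = K * δ * (1 + δ⁻¹) ^ m * (lam ^ n)⁻¹ * (1 + t) ^ (m + n) * d ^ (2 * m + 2 * n) := by
          rw [mul_pow, mul_pow]; ring
      _ ≤ K * δ * (1 + δ⁻¹) ^ m * (lam ^ n)⁻¹ * (C * E) * d ^ (w + 2) := by
          refine mul_le_mul (mul_le_mul_of_nonneg_left ?_ (by positivity)) ?_ (by positivity)
            (by positivity)
          · exact (pow_le_pow_right₀ h1t (by omega)).trans he
          · exact pow_le_pow_right₀ h (by omega)
      _ = K₀ * d ^ (w + 2) * E := by rw [hK₀]; ring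
      _ ≤ _ := by
          gcongr
          have : 0 < ((2 * lam) ^ (w + 2))⁻¹ := by positivity
          nlinarith
  · have h1 : 1 + t * d ^ 2 / δ ≤ (1 + δ⁻¹) * (1 + t) := by
      have hd2 : d ^ 2 ≤ 1 := pow_le_one₀ hd.le h
      have : 0 < δ⁻¹ := by positivity
      have h3 : t * d ^ 2 ≤ t := by nlinarith
      rw [div_eq_mul_inv]
      nlinarith [mul_le_mul_of_nonneg_right h3 this.le]
    have h2 : 1 ≤ ((2 * lam) ^ (w + 2))⁻¹ * ((1 + t) * d) ^ (w + 2) := by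
      rw [← div_eq_inv_mul, one_le_div (by positivity)]
      gcongr
    have h4 : d ^ (2 * n) ≤ 1 := pow_le_one₀ hd.le h
    calc K * δ * (1 + t * d ^ 2 / δ) ^ m * S ^ n
        ≤ K * δ * ((1 + δ⁻¹) * (1 + t)) ^ m *
          ((lam ^ n)⁻¹ * ((1 + t) ^ n * 1)) * 1 := by
          rw [mul_one]
          gcongr
          exact hSn.trans (by gcongr)
      _ ≤ K * δ * ((1 + δ⁻¹) * (1 + t)) ^ m * ((lam ^ n)⁻¹ * ((1 + t) ^ n * 1)) *
          (((2 * lam) ^ (w + 2))⁻¹ * ((1 + t) * d) ^ (w + 2)) := by gcongr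
      _ = K * δ * (1 + δ⁻¹) ^ m * (lam ^ n)⁻¹ * ((2 * lam) ^ (w + 2))⁻¹ *
          (1 + t) ^ (m + n + (w + 2)) * d ^ (w + 2) := by
          rw [mul_pow _ (1 + t) m, mul_pow _ d (w + 2), pow_add (1 + t) (m + n),
            pow_add (1 + t) m]
          generalize ((2 * lam) ^ (w + 2))⁻¹ = x
          generalize (1 + t) ^ (w + 2) = y
          generalize d ^ (w + 2) = z
          ring
      _ ≤ K * δ * (1 + δ⁻¹) ^ m * (lam ^ n)⁻¹ * ((2 * lam) ^ (w + 2))⁻¹ *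
          (C * E) * d ^ (w + 2) := by gcongr
      _ = K₀ * ((2 * lam) ^ (w + 2))⁻¹ * d ^ (w + 2) * E := by rw [hK₀]; ring
      _ ≤ _ := by gcongr; linarith

/-- Every term decays like any prescribed power of the Frobenius norm of `CZ + D`, provided that `ℓ`
is large. -/
theorem exists_norm_slash_seed_le (k : ℕ) (hk : 0 < k) {T T' : Mat2 ℝ} (hT : T.PosDef)
    (hT' : T'.PosDef) (n : ℕ) {l : ℕ} (hl : 3 * k + 2 * n + 8 ≤ l) {Z : Mat2 ℂ}
    (hZ : Z ∈ upperHalfSpace) :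
    ∃ K : ℝ, 0 < K ∧ ∀ M : Gam, ‖slash ((k : ℤ) + l) (seed k T T') M Z‖ ≤
      K * (sqNorm (denom M Z) ^ n)⁻¹ := by
  obtain ⟨K, c, hK, hc, hseed⟩ := exists_norm_seed_le k hk hT hT'
  have hYd := hZ.2.det_pos
  have hYt := hZ.2.trace_pos
  obtain ⟨K', hK', hterm⟩ := exists_term_le hK hc hYd (div_pos hYd hYt)
    (m := 2 * k + 4) (n := n) (w := k + l) (by omega)
  refine ⟨K', hK', fun M => ?_⟩
  have hS0 : 0 ≤ sqNorm (denom M Z) :=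
    (by positivity : 0 ≤ 2 * ‖(denom M Z).det‖).trans (two_mul_norm_det_le _)
  by_cases hd : (denom M Z).det = 0
  -- the junk value `0⁻ʷ = 0` makes the term vanish, so invertibility of `CZ + D` is not needed
  · rw [slash, hd, _root_.zero_zpow _ (by omega), zero_mul, norm_zero]
    positivity
  have hdp : 0 < ‖(denom M Z).det‖ := norm_pos_iff.2 hd
  have htr := le_trace_imMat_act M hZ hd
  have hdet := det_imMat_act M hZ.1 hd
  have hSd := two_mul_norm_det_le (denom M Z)
  have hsymm : imMat (act M Z) 1 0 = imMat (act M Z) 0 1 :=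
    congrArg Complex.im ((act_isSymm M hZ.1 hd).apply 0 1)
  have htpos : 0 < (imMat (act M Z)).trace := by
    refine lt_of_lt_of_le ?_ htr
    have : 0 < sqNorm (denom M Z) := by linarith
    positivity
  have h1 := hseed (act M Z) hsymm htpos (by rw [hdet]; positivity)
  have h2 := hterm _ _ _ hdp hSd htr
  rw [hdet] at h1
  rw [slash, norm_mul, norm_zpow, _root_.zpow_neg]
  rw [show (k : ℤ) + l = ((k + l : ℕ) : ℤ) by push_cast; ring, zpow_natCast]
  exact (mul_le_mul_of_nonneg_left h1 (by positivity)).trans h2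

/-! ### Absolute convergence -/

/-- The lower left block of a symplectic matrix, with integral entries. -/
def intC (M : Gam) : Mat2 ℤ := (M : Matrix (Fin 2 ⊕ Fin 2) (Fin 2 ⊕ Fin 2) ℤ).toBlocks₂₁

/-- The lower right block of a symplectic matrix, with integral entries. -/
def intD (M : Gam) : Mat2 ℤ := (M : Matrix (Fin 2 ⊕ Fin 2) (Fin 2 ⊕ Fin 2) ℤ).toBlocks₂₂

theorem blockC_apply (M : Gam) (i j : Fin 2) : blockC M i j = (intC M i j : ℂ) := rfl

theorem blockD_apply (M : Gam) (i j : Fin 2) : blockD M i j = (intD M i j : ℂ) := rfl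

/-- The upper left block of a symplectic matrix, with integral entries. -/
def intA (M : Gam) : Mat2 ℤ := (M : Matrix (Fin 2 ⊕ Fin 2) (Fin 2 ⊕ Fin 2) ℤ).toBlocks₁₁

/-- The upper right block of a symplectic matrix, with integral entries. -/
def intB (M : Gam) : Mat2 ℤ := (M : Matrix (Fin 2 ⊕ Fin 2) (Fin 2 ⊕ Fin 2) ℤ).toBlocks₁₂

/-- The relations between the rows of a symplectic matrix. -/
theorem block_relations_rows (M : Gam) :
    intA M * (intB M)ᵀ = intB M * (intA M)ᵀ ∧ intC M * (intD M)ᵀ = intD M * (intC M)ᵀ ∧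
      intA M * (intD M)ᵀ - intB M * (intC M)ᵀ = 1 := by
  have h := SymplecticGroup.transpose_mem M.2
  rw [← fromBlocks_toBlocks (M : Matrix (Fin 2 ⊕ Fin 2) (Fin 2 ⊕ Fin 2) ℤ),
    fromBlocks_transpose, SymplecticGroup.fromBlocks_mem_iff] at h
  simpa only [transpose_transpose, intA, intB, intC, intD] using h

/-- The bottom row `(C, D)` determines a symplectic matrix up to translations from the left. -/
theorem mul_inv_mem_translations {M N : Gam} (hC : intC M = intC N) (hD : intD M = intD N) :
    N * M⁻¹ ∈ translations := by
  have hmul : ∀ (P Q : Gam),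
      intC (P * Q) = intC P * (Q : Matrix (Fin 2 ⊕ Fin 2) (Fin 2 ⊕ Fin 2) ℤ).toBlocks₁₁ +
        intD P * intC Q ∧
      intD (P * Q) = intC P * (Q : Matrix (Fin 2 ⊕ Fin 2) (Fin 2 ⊕ Fin 2) ℤ).toBlocks₁₂ +
        intD P * intD Q := by
    intro P Q
    have : ((P * Q : Gam) : Matrix (Fin 2 ⊕ Fin 2) (Fin 2 ⊕ Fin 2) ℤ) =
        (P : Matrix (Fin 2 ⊕ Fin 2) (Fin 2 ⊕ Fin 2) ℤ) * Q := rfl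
    rw [← fromBlocks_toBlocks (P : Matrix (Fin 2 ⊕ Fin 2) (Fin 2 ⊕ Fin 2) ℤ),
      ← fromBlocks_toBlocks (Q : Matrix (Fin 2 ⊕ Fin 2) (Fin 2 ⊕ Fin 2) ℤ),
      fromBlocks_multiply] at this
    constructor
    · rw [intC, this, toBlocks_fromBlocks₂₁]; rfl
    · rw [intD, this, toBlocks_fromBlocks₂₂]; rfl
  have h1 : intC (N * M⁻¹) = 0 := by
    rw [(hmul _ _).1, ← hC, ← hD, ← (hmul _ _).1, mul_inv_cancel]
    ext i j
    fin_cases i <;> fin_cases j <;> rfl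
  have h2 : intD (N * M⁻¹) = 1 := by
    rw [(hmul _ _).2, ← hC, ← hD, ← (hmul _ _).2, mul_inv_cancel]
    ext i j
    fin_cases i <;> fin_cases j <;> rfl
  have h := (N * M⁻¹).2
  rw [mem_translations]
  generalize N * M⁻¹ = P at h1 h2 h
  rw [intC] at h1
  rw [intD] at h2
  rw [← fromBlocks_toBlocks (P : Matrix (Fin 2 ⊕ Fin 2) (Fin 2 ⊕ Fin 2) ℤ), h1, h2,
    SymplecticGroup.fromBlocks_mem_iff] at h
  simp only [Matrix.mul_one, transpose_one, Matrix.one_mul, transpose_zero, Matrix.zero_mul,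
    sub_zero] at h
  refine ⟨(P : Matrix (Fin 2 ⊕ Fin 2) (Fin 2 ⊕ Fin 2) ℤ).toBlocks₁₂, h.2.1, ?_⟩
  conv_lhs => rw [← fromBlocks_toBlocks (P : Matrix (Fin 2 ⊕ Fin 2) (Fin 2 ⊕ Fin 2) ℤ), h1, h2]
  rw [← transpose_transpose (toBlocks₁₁ _), h.2.2, transpose_one]

theorem intC_eq_zero_iff (M : Gam) : intC M = 0 ↔ blockC M = 0 := by
  simp only [← Matrix.ext_iff, blockC_apply, Matrix.zero_apply, Int.cast_eq_zero]

theorem bottom_row_ne_zero (M : Gam) : ∃ i j, intC M i j ≠ 0 ∨ intD M i j ≠ 0 := by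
  by_contra! h
  have hC : blockC M = 0 := by ext i j; simp [blockC_apply, (h i j).1]
  have hD : blockD M = 0 := by ext i j; simp [blockD_apply, (h i j).2]
  have := (block_relations M).2.2
  rw [hC, hD] at this
  simp at this

/-- All entries of `C` and `D` are bounded by a multiple of the Frobenius norm of `CZ + D`,
because `C = Im(CZ+D) Y⁻¹` and `D = Re(CZ+D) - CX`. -/
theorem exists_one_add_sq_le {Z : Mat2 ℂ} (hZ : Z ∈ upperHalfSpace) :
    ∃ κ : ℝ, 0 < κ ∧ ∀ (M : Gam) (i j : Fin 2),
      1 + (intC M i j : ℝ) ^ 2 ≤ κ * sqNorm (denom M Z) ∧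
        1 + (intD M i j : ℝ) ^ 2 ≤ κ * sqNorm (denom M Z) := by
  set η : ℝ := ∑ i, ∑ j, |(imMat Z)⁻¹ i j| with hη
  set ξ : ℝ := ∑ i, ∑ j, |reMat Z i j| with hξ
  have hη0 : 0 ≤ η := by positivity
  have hξ0 : 0 ≤ ξ := by positivity
  refine ⟨2 * (1 + η + η * ξ) ^ 2, by positivity, fun M => ?_⟩
  set S := sqNorm (denom M Z) with hS
  set s := Real.sqrt S with hs
  have hS0 : 0 ≤ S := (by positivity : 0 ≤ 2 * ‖(denom M Z).det‖).trans (two_mul_norm_det_le _)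
  have hs0 : 0 ≤ s := Real.sqrt_nonneg _
  have hentry : ∀ i j, ‖denom M Z i j‖ ≤ s := by
    intro i j
    refine Real.le_sqrt_of_sq_le ?_
    rw [← Complex.normSq_eq_norm_sq, hS, sqNorm]
    exact (Finset.single_le_sum (f := fun j => Complex.normSq (denom M Z i j))
      (fun _ _ => Complex.normSq_nonneg _) (Finset.mem_univ j)).trans
      (Finset.single_le_sum (f := fun i => ∑ j, Complex.normSq (denom M Z i j))
        (fun _ _ => Finset.sum_nonneg fun _ _ => Complex.normSq_nonneg _) (Finset.mem_univ i))
  set C : Mat2 ℝ := (intC M).map (fun n : ℤ => (n : ℝ)) with hC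
  set D : Mat2 ℝ := (intD M).map (fun n : ℤ => (n : ℝ)) with hD
  have him : imMat (denom M Z) = C * imMat Z := by
    ext i j
    simp [imMat, denom, Matrix.mul_apply, Fin.sum_univ_two, blockC_apply, blockD_apply, hC]
  have hre : reMat (denom M Z) = C * reMat Z + D := by
    ext i j
    simp [reMat, denom, Matrix.mul_apply, Fin.sum_univ_two, blockC_apply, blockD_apply, hC, hD]
  have hu : IsUnit (imMat Z).det := hZ.2.det_pos.ne'.isUnit
  have habs : ∀ (A B : Mat2 ℝ) (r : ℝ), (∀ i j, |A i j| ≤ r) → ∀ i j,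
      |(A * B) i j| ≤ r * ∑ i, ∑ j, |B i j| := by
    intro A B r hA i j
    have hr : 0 ≤ r := (abs_nonneg _).trans (hA i j)
    rw [Matrix.mul_apply, Finset.mul_sum]
    refine (Finset.abs_sum_le_sum_abs _ _).trans (Finset.sum_le_sum fun x _ => ?_)
    rw [abs_mul]
    refine mul_le_mul (hA i x) ?_ (abs_nonneg _) hr
    exact Finset.single_le_sum (f := fun j => |B x j|) (fun _ _ => abs_nonneg _)
      (Finset.mem_univ j)
  have hCle : ∀ i j, |C i j| ≤ s * η := by
    have h1 : C = imMat (denom M Z) * (imMat Z)⁻¹ := by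
      rw [him, mul_nonsing_inv_cancel_right _ _ hu]
    rw [h1]
    exact habs _ _ _ fun i j => (Complex.abs_im_le_norm _).trans (hentry i j)
  have hDle : ∀ i j, |D i j| ≤ s + s * η * ξ := by
    intro i j
    have h1 : D i j = reMat (denom M Z) i j - (C * reMat Z) i j := by rw [hre]; simp
    rw [h1]
    exact (abs_sub _ _).trans (add_le_add ((Complex.abs_re_le_norm _).trans (hentry i j))
      (habs _ _ _ hCle i j))
  set R := s * (1 + η + η * ξ) with hR
  have hCR : ∀ i j, |(intC M i j : ℝ)| ≤ R := fun i j => (hCle i j).trans (by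
    rw [hR]; nlinarith [mul_nonneg hs0 (mul_nonneg hη0 hξ0)])
  have hDR : ∀ i j, |(intD M i j : ℝ)| ≤ R := fun i j => (hDle i j).trans (by
    rw [hR]; nlinarith [mul_nonneg hs0 hη0])
  have hR1 : 1 ≤ R := by
    have hone : ∀ n : ℤ, n ≠ 0 → (1 : ℝ) ≤ |(n : ℝ)| := fun n hn => by
      exact_mod_cast Int.one_le_abs hn
    obtain ⟨i, j, h | h⟩ := bottom_row_ne_zero M
    · exact (hone _ h).trans (hCR i j)
    · exact (hone _ h).trans (hDR i j)
  have hR2 : 2 * (1 + η + η * ξ) ^ 2 * S = 2 * R ^ 2 := by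
    rw [hR, mul_pow, hs, Real.sq_sqrt hS0]; ring
  intro i j
  rw [hR2]
  have h1 := pow_le_pow_left₀ (abs_nonneg _) (hCR i j) 2
  have h2 := pow_le_pow_left₀ (abs_nonneg _) (hDR i j) 2
  rw [sq_abs] at h1 h2
  constructor <;> nlinarith

theorem summable_inv_one_add_sq : Summable fun n : ℤ => (1 + (n : ℝ) ^ 2)⁻¹ := by
  have h : Summable fun n : ℕ => (1 + (n : ℝ) ^ 2)⁻¹ := by
    refine Summable.of_norm_bounded_eventually_nat (Real.summable_nat_pow_inv.2 one_lt_two) ?_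
    filter_upwards [eventually_gt_atTop 0] with n hn
    rw [Real.norm_of_nonneg (by positivity)]
    gcongr
    linarith
  refine Summable.of_nat_of_neg (by simpa using h) (by simpa using h)

/-- The eight entries of the bottom row `(C, D)`. -/
def bottomRow (M : Gam) : ((ℤ × ℤ) × ℤ × ℤ) × ((ℤ × ℤ) × ℤ × ℤ) :=
  (((intC M 0 0, intC M 0 1), intC M 1 0, intC M 1 1),
    ((intD M 0 0, intD M 0 1), intD M 1 0, intD M 1 1))

theorem bottomRow_out_injective : Function.Injective
    (fun q : Quotient (QuotientGroup.rightRel translations) => bottomRow q.out) := by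
  intro q q' h
  simp only [bottomRow, Prod.mk.injEq] at h
  obtain ⟨⟨⟨h1, h2⟩, h3, h4⟩, ⟨h5, h6⟩, h7, h8⟩ := h
  have hC : intC q.out = intC q'.out := by
    ext i j; fin_cases i <;> fin_cases j <;> assumption
  have hD : intD q.out = intD q'.out := by
    ext i j; fin_cases i <;> fin_cases j <;> assumption
  rw [← Quotient.out_eq q, ← Quotient.out_eq q']
  exact Quotient.sound (QuotientGroup.rightRel_apply.2 (mul_inv_mem_translations hC hD))

/-- The summable function `∏ (1 + vᵢ²)⁻¹` on `ℤ⁸`. -/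
def latticeBound (v : ((ℤ × ℤ) × ℤ × ℤ) × ((ℤ × ℤ) × ℤ × ℤ)) : ℝ :=
  ((1 + (v.1.1.1 : ℝ) ^ 2)⁻¹ * (1 + (v.1.1.2 : ℝ) ^ 2)⁻¹ *
    ((1 + (v.1.2.1 : ℝ) ^ 2)⁻¹ * (1 + (v.1.2.2 : ℝ) ^ 2)⁻¹)) *
  ((1 + (v.2.1.1 : ℝ) ^ 2)⁻¹ * (1 + (v.2.1.2 : ℝ) ^ 2)⁻¹ *
    ((1 + (v.2.2.1 : ℝ) ^ 2)⁻¹ * (1 + (v.2.2.2 : ℝ) ^ 2)⁻¹))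

theorem summable_latticeBound : Summable latticeBound := by
  have h1 := summable_inv_one_add_sq
  have n1 : (0 : ℤ → ℝ) ≤ fun n : ℤ => (1 + (n : ℝ) ^ 2)⁻¹ := fun n =>
    inv_nonneg.2 (add_nonneg zero_le_one (sq_nonneg _))
  have h2 := h1.mul_of_nonneg h1 n1 n1
  have n2 : (0 : ℤ × ℤ → ℝ) ≤ fun x => (1 + (x.1 : ℝ) ^ 2)⁻¹ * (1 + (x.2 : ℝ) ^ 2)⁻¹ :=
    fun x => mul_nonneg (n1 _) (n1 _)
  have h4 := h2.mul_of_nonneg h2 n2 n2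
  have n4 : (0 : (ℤ × ℤ) × ℤ × ℤ → ℝ) ≤ fun x =>
      (1 + (x.1.1 : ℝ) ^ 2)⁻¹ * (1 + (x.1.2 : ℝ) ^ 2)⁻¹ *
        ((1 + (x.2.1 : ℝ) ^ 2)⁻¹ * (1 + (x.2.2 : ℝ) ^ 2)⁻¹) :=
    fun x => mul_nonneg (n2 _) (n2 _)
  exact h4.mul_of_nonneg h4 n4 n4

theorem exists_inv_sqNorm_pow_le {Z : Mat2 ℂ} (hZ : Z ∈ upperHalfSpace) :
    ∃ K : ℝ, 0 < K ∧ ∀ M : Gam, (sqNorm (denom M Z) ^ 8)⁻¹ ≤ K * latticeBound (bottomRow M) := by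
  obtain ⟨κ, hκ, h⟩ := exists_one_add_sq_le hZ
  refine ⟨κ ^ 8, by positivity, fun M => ?_⟩
  have hS : 0 < sqNorm (denom M Z) := by
    have h1 := (h M 0 0).1
    exact pos_of_mul_pos_right (lt_of_lt_of_le (by positivity) h1) hκ.le
  rw [latticeBound, bottomRow]
  simp only [← mul_inv]
  rw [← div_eq_mul_inv, inv_le_iff_one_le_mul₀ (by positivity), div_mul_eq_mul_div,
    one_le_div (by positivity), ← mul_pow]
  have h := h M
  generalize κ * sqNorm (denom M Z) = R at h
  have hp : ∀ n : ℤ, 0 ≤ 1 + (n : ℝ) ^ 2 := fun n => by positivity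
  have hR : 0 ≤ R := (hp _).trans (h 0 0).1
  have h4 : ∀ a b c d : ℤ, 1 + (a : ℝ) ^ 2 ≤ R → 1 + (b : ℝ) ^ 2 ≤ R → 1 + (c : ℝ) ^ 2 ≤ R →
      1 + (d : ℝ) ^ 2 ≤ R →
      (1 + (a : ℝ) ^ 2) * (1 + (b : ℝ) ^ 2) * ((1 + (c : ℝ) ^ 2) * (1 + (d : ℝ) ^ 2)) ≤
        R * R * (R * R) := fun a b c d ha hb hc hd =>
    mul_le_mul (mul_le_mul ha hb (hp _) hR) (mul_le_mul hc hd (hp _) hR)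
      (mul_nonneg (hp _) (hp _)) (mul_nonneg hR hR)
  refine (mul_le_mul (h4 _ _ _ _ (h 0 0).1 (h 0 1).1 (h 1 0).1 (h 1 1).1)
    (h4 _ _ _ _ (h 0 0).2 (h 0 1).2 (h 1 0).2 (h 1 1).2) ?_ (by positivity)).trans_eq (by ring)
  exact mul_nonneg (mul_nonneg (hp _) (hp _)) (mul_nonneg (hp _) (hp _))

theorem poincareTerm_eq (k l : ℕ) {T T' : Mat2 ℝ} (hT : IsHalfIntegral T)
    (hT' : IsHalfIntegral T') (Z : Mat2 ℂ) (q : Quotient (QuotientGroup.rightRel translations)) :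
    poincareTerm k l T T' hT hT' Z q = slash ((k : ℤ) + l) (seed k T T') q.out Z := by
  conv_lhs => rw [← Quotient.out_eq q]
  rfl

theorem summable_norm_poincareTerm {k l : ℕ} (hk : 0 < k) (hl : 3 * k + 24 ≤ l) {T T' : Mat2 ℝ}
    (hT : IsHalfIntegral T) (hT' : IsHalfIntegral T') (hTp : T.PosDef) (hTp' : T'.PosDef)
    {Z : Mat2 ℂ} (hZ : Z ∈ upperHalfSpace) :
    Summable fun q => ‖poincareTerm k l T T' hT hT' Z q‖ := by
  obtain ⟨K, hK, h1⟩ := exists_norm_slash_seed_le k hk hTp hTp' 8 (l := l) (by omega) hZ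
  obtain ⟨K', -, h2⟩ := exists_inv_sqNorm_pow_le hZ
  refine Summable.of_nonneg_of_le (fun _ => norm_nonneg _) (fun q => ?_)
    ((summable_latticeBound.comp_injective bottomRow_out_injective).mul_left (K * K'))
  rw [poincareTerm_eq, mul_assoc]
  exact (h1 _).trans (mul_le_mul_of_nonneg_left (h2 _) hK.le)

/-! ### The terms at `2iI` -/

/-- The point `2iI`. -/
def basePoint : Mat2 ℂ := (Complex.I * ((2 : ℝ) : ℂ)) • (1 : Mat2 ℂ)

theorem basePoint_mem : basePoint ∈ upperHalfSpace := by
  refine ⟨by simp [Matrix.IsSymm, basePoint], posDef_fin_two_iff.2 ?_⟩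
  simp [imMat, basePoint]

/-- `|det(2iC + D)|² = 16 det(C)² + 4 |adj(C) D|² + det(D)²`, where `adj(C) D` is symmetric. -/
theorem norm_det_denom_basePoint_sq (M : Gam) :
    ∃ e₁ e₂ e₃ : ℤ, (intC M).adjugate * intD M = !![e₁, e₂; e₂, e₃] ∧
      ‖(denom M basePoint).det‖ ^ 2 =
        ((16 * (intC M).det ^ 2 + 4 * (e₁ ^ 2 + 2 * e₂ ^ 2 + e₃ ^ 2) +
          (intD M).det ^ 2 : ℤ) : ℝ) := by
  have hrel := congrFun (congrFun (block_relations_rows M).2.1 0) 1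
  simp only [Matrix.mul_apply, Fin.sum_univ_two, transpose_apply] at hrel
  have hre : (denom M basePoint).det.re = (((intD M).det - 4 * (intC M).det : ℤ) : ℝ) := by
    simp [denom, basePoint, det_fin_two, blockC_apply, blockD_apply]
    ring
  have him : (denom M basePoint).det.im = ((2 * (intC M 0 0 * intD M 1 1 + intC M 1 1 * intD M 0 0 -
      intC M 0 1 * intD M 1 0 - intC M 1 0 * intD M 0 1) : ℤ) : ℝ) := by
    simp [denom, basePoint, det_fin_two, blockC_apply, blockD_apply]
    ring
  refine ⟨intC M 1 1 * intD M 0 0 - intC M 0 1 * intD M 1 0,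
    intC M 1 1 * intD M 0 1 - intC M 0 1 * intD M 1 1,
    intC M 0 0 * intD M 1 1 - intC M 1 0 * intD M 0 1, ?_, ?_⟩
  · rw [adjugate_fin_two]
    ext i j
    fin_cases i <;> fin_cases j <;> simp [Matrix.mul_apply, Fin.sum_univ_two] <;> linarith
  · rw [← Complex.normSq_eq_norm_sq, Complex.normSq_apply, hre, him]
    norm_cast
    simp only [det_fin_two]
    generalize intC M 0 0 = a at *
    generalize intC M 0 1 = b at *
    generalize intC M 1 0 = c at *
    generalize intC M 1 1 = d at *
    generalize intD M 0 0 = p at *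
    generalize intD M 0 1 = q at *
    generalize intD M 1 0 = r at *
    generalize intD M 1 1 = s at *
    linear_combination 8 * (d * q - b * s) * hrel

theorem det_intA_mul_det_intD {M : Gam} (hC : blockC M = 0) :
    (intA M).det * (intD M).det = 1 := by
  have h := (block_relations_rows M).2.2
  rw [(intC_eq_zero_iff M).2 hC, transpose_zero, Matrix.mul_zero, sub_zero] at h
  simpa using congrArg Matrix.det h

theorem det_denom_of_blockC_eq_zero {M : Gam} (hC : blockC M = 0) (Z : Mat2 ℂ) :
    (denom M Z).det ^ 2 = 1 ∧ ‖(denom M Z).det‖ = 1 := by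
  have hu : IsUnit (intD M).det := IsUnit.of_mul_eq_one_right _ (det_intA_mul_det_intD hC)
  have hD : (denom M Z).det = ((intD M).det : ℂ) := by
    simp [denom, hC, det_fin_two, blockD_apply]
  rw [hD]
  rcases Int.isUnit_iff.1 hu with h | h <;> simp [h]

theorem one_lt_norm_det_denom (M : Gam) (hC : blockC M ≠ 0) :
    1 < ‖(denom M basePoint).det‖ := by
  obtain ⟨e₁, e₂, e₃, he, hn⟩ := norm_det_denom_basePoint_sq M
  have hpos : 1 ≤ (intC M).det ^ 2 + (e₁ ^ 2 + 2 * e₂ ^ 2 + e₃ ^ 2) := by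
    by_contra! h
    have n0 := sq_nonneg (intC M).det
    have n1 := sq_nonneg e₁
    have n2 := sq_nonneg e₂
    have n3 := sq_nonneg e₃
    have hdet : (intC M).det = 0 := by
      rw [← sq_eq_zero_iff]; omega
    have h1 : e₁ = 0 := by
      rw [← sq_eq_zero_iff]; omega
    have h2 : e₂ = 0 := by
      rw [← sq_eq_zero_iff]; omega
    have h3 : e₃ = 0 := by
      rw [← sq_eq_zero_iff]; omega
    -- `adj(C)` annihilates both `C` and `D`, hence vanishes because `(C, D)` is unimodular
    have hED : (intC M).adjugate * intD M = 0 := by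
      rw [he, h1, h2, h3]; ext i j; fin_cases i <;> fin_cases j <;> rfl
    have hEC : (intC M).adjugate * intC M = 0 := by rw [adjugate_mul, hdet, zero_smul]
    have hone := congrArg Matrix.transpose (block_relations_rows M).2.2
    simp only [transpose_sub, transpose_mul, transpose_transpose, transpose_one] at hone
    have hE : (intC M).adjugate = 0 := by
      rw [← Matrix.mul_one (intC M).adjugate, ← hone, Matrix.mul_sub, ← Matrix.mul_assoc,
        ← Matrix.mul_assoc, hED, hEC, Matrix.zero_mul, Matrix.zero_mul, sub_zero]
    refine hC ?_
    rw [adjugate_fin_two] at hE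
    have h00 := congrFun (congrFun hE 0) 0
    have h01 := congrFun (congrFun hE 0) 1
    have h10 := congrFun (congrFun hE 1) 0
    have h11 := congrFun (congrFun hE 1) 1
    simp only [of_apply, cons_val', cons_val_zero, cons_val_one, cons_val_fin_one,
      Matrix.zero_apply, neg_eq_zero] at h00 h01 h10 h11
    rw [← intC_eq_zero_iff]
    ext i j
    fin_cases i <;> fin_cases j <;> assumption
  have h4 : (4 : ℤ) ≤ 16 * (intC M).det ^ 2 + 4 * (e₁ ^ 2 + 2 * e₂ ^ 2 + e₃ ^ 2) +
      (intD M).det ^ 2 := by nlinarith [sq_nonneg (intC M).det, sq_nonneg (intD M).det]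
  have h5 : (4 : ℝ) ≤ ‖(denom M basePoint).det‖ ^ 2 := by rw [hn]; exact_mod_cast h4
  nlinarith [norm_nonneg (denom M basePoint).det]

/-- For `C = 0` the point `M • 2iI` is an integral translate of `2i AAᵗ`, so the seed is
positive there. -/
theorem seed_act_pos {k : ℕ} (hk : 0 < k) {T T' : Mat2 ℝ} (hT : IsHalfIntegral T)
    (hT' : IsHalfIntegral T') (hTp : T.PosDef) (M : Gam)
    (hC : blockC M = 0) : ∃ r : ℝ, 0 < r ∧ seed k T T' (act M basePoint) = r := by
  have hAD : (blockA M)ᵀ * blockD M = 1 := by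
    have := (block_relations M).2.2
    rwa [hC, transpose_zero, Matrix.zero_mul, sub_zero] at this
  have hinv : (blockD M)⁻¹ = (blockA M)ᵀ := inv_eq_left_inv hAD
  have hAunit : (intA M).det ^ 2 = 1 := by
    rcases Int.isUnit_iff.1 (IsUnit.of_mul_eq_one _ (det_intA_mul_det_intD hC)) with h | h <;>
      simp [h]
  have hBA : (intB M * (intA M)ᵀ).IsSymm := by
    rw [Matrix.IsSymm, transpose_mul, transpose_transpose]
    exact (block_relations_rows M).1
  have hact : act M basePoint =
      (Complex.I * ((2 : ℝ) : ℂ)) • (intToC (intA M * (intA M)ᵀ)) +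
        intToC (intB M * (intA M)ᵀ) := by
    rw [act, denom, hC, Matrix.zero_mul, zero_add, hinv, Matrix.add_mul, basePoint,
      Matrix.mul_smul, Matrix.mul_one, Matrix.smul_mul, intToC_mul, intToC_mul, intToC_transpose]
    rfl
  generalize intA M = A at *
  generalize intB M * Aᵀ = B at *
  rw [hact, seed_add hT hT' _ hBA]
  set Z₁ := (Complex.I * ((2 : ℝ) : ℂ)) • (intToC (A * Aᵀ)) with hZ₁
  have hre : reMat Z₁ = 0 := by
    ext i j; simp [reMat, hZ₁, intToC]
  have him : imMat Z₁ = (2 : ℝ) • (A * Aᵀ).map (fun n : ℤ => (n : ℝ)) := by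
    ext i j; simp [imMat, hZ₁, intToC]
  have hZ₁' : Z₁ = Complex.I • toC (imMat Z₁) := by
    rw [him, hZ₁]
    ext i j
    simp [toC, intToC, mul_assoc]
  have hAR : (A 0 0 * A 1 1 - A 0 1 * A 1 0 : ℝ) ^ 2 = 1 := by
    rw [det_fin_two] at hAunit
    exact_mod_cast hAunit
  have hYs : imMat Z₁ 1 0 = imMat Z₁ 0 1 := by
    rw [him]; simp [Matrix.mul_apply, Fin.sum_univ_two]; ring
  have hYd : 0 < (imMat Z₁).det := by
    have : (imMat Z₁).det = 4 * (A 0 0 * A 1 1 - A 0 1 * A 1 0 : ℝ) ^ 2 := by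
      rw [him]; simp [Matrix.mul_apply, Fin.sum_univ_two, det_fin_two]; ring
    rw [this, hAR]; norm_num
  have hYt : 0 < (imMat Z₁).trace := by
    have : (imMat Z₁).trace = 2 * ((A 0 0 : ℝ) ^ 2 + (A 0 1 : ℝ) ^ 2 + (A 1 0 : ℝ) ^ 2 +
        (A 1 1 : ℝ) ^ 2) := by
      rw [him]; simp [Matrix.mul_apply, Fin.sum_univ_two, trace_fin_two]; ring
    rw [this]
    by_contra! h
    have h00 : (A 0 0 : ℝ) = 0 := by nlinarith
    have h01 : (A 0 1 : ℝ) = 0 := by nlinarith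
    rw [h00, h01] at hAR
    norm_num at hAR
  have hh := hFun_pos k hk hTp hYs hYt hYd
  have hTd := hTp.det_pos
  refine ⟨(T * imMat Z₁).det * hFun (k + 1) 1 T (imMat Z₁) *
    Real.exp (-(2 * Real.pi * (T' * imMat Z₁).trace)), ?_, ?_⟩
  · rw [det_mul]; positivity
  · rw [seed, Psi, hre, Phi]
    have htr : (toC T' * Z₁).trace = Complex.I * ((T' * imMat Z₁).trace : ℝ) := by
      conv_lhs => rw [hZ₁']
      simp only [Matrix.mul_smul, trace_smul, smul_eq_mul]
      simp [toC, trace_fin_two, Matrix.mul_apply, Fin.sum_univ_two]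
    rw [htr, show 2 * (Real.pi : ℂ) * Complex.I * (Complex.I * ((T' * imMat Z₁).trace : ℝ)) =
      ((-(2 * Real.pi * (T' * imMat Z₁).trace) : ℝ) : ℂ) by
        push_cast; linear_combination (2 * (Real.pi : ℂ) * ((T' * imMat Z₁).trace : ℝ)) *
          Complex.I_mul_I]
    rw [← Complex.ofReal_exp]
    simp

/-! ### The limit of the series at `2iI` -/

theorem norm_poincareTerm (k l : ℕ) {T T' : Mat2 ℝ} (hT : IsHalfIntegral T)
    (hT' : IsHalfIntegral T') (Z : Mat2 ℂ) (q : Quotient (QuotientGroup.rightRel translations)) :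
    ‖poincareTerm k l T T' hT hT' Z q‖ =
      (‖(denom q.out Z).det‖ ^ (k + l))⁻¹ * ‖seed k T T' (act q.out Z)‖ := by
  rw [poincareTerm_eq, slash, norm_mul, norm_zpow, _root_.zpow_neg,
    show (k : ℤ) + l = ((k + l : ℕ) : ℤ) by push_cast; ring, zpow_natCast]

theorem one_le_norm_det_denom (M : Gam) : 1 ≤ ‖(denom M basePoint).det‖ := by
  by_cases hC : blockC M = 0
  · exact (det_denom_of_blockC_eq_zero hC _).2.ge
  · exact (one_lt_norm_det_denom M hC).le

open scoped Classical in
/-- The limit of the term of the coset `q` at `2iI`: only the cosets with `C = 0` contribute. -/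
def limitTerm (k : ℕ) (T T' : Mat2 ℝ) (q : Quotient (QuotientGroup.rightRel translations)) : ℝ :=
  if blockC q.out = 0 then (seed k T T' (act q.out basePoint)).re else 0

theorem tendsto_poincareTerm {k : ℕ} (hk : 0 < k) (hke : Even k) {T T' : Mat2 ℝ}
    (hT : IsHalfIntegral T) (hT' : IsHalfIntegral T') (hTp : T.PosDef)
    (q : Quotient (QuotientGroup.rightRel translations)) :
    Tendsto (fun l : ℕ => poincareTerm k l T T' hT hT' basePoint q)
      (atTop ⊓ 𝓟 {l : ℕ | Even l}) (𝓝 (limitTerm k T T' q : ℂ)) := by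
  by_cases hC : blockC q.out = 0
  · obtain ⟨r, -, hr⟩ := seed_act_pos hk hT hT' hTp q.out hC
    rw [limitTerm, if_pos hC]
    refine tendsto_const_nhds.congr' ?_
    filter_upwards [mem_inf_of_right (mem_principal_self _)] with l hl
    obtain ⟨m, hm⟩ := hke.add hl
    -- the weight is even and `det(CZ + D) = ±1`
    have hz : ((denom q.out basePoint).det ^ (-((k : ℤ) + l)) : ℂ) = 1 := by
      rw [_root_.zpow_neg, show (k : ℤ) + l = ((2 * m : ℕ) : ℤ) by rw [← two_mul] at hm; omega,
        zpow_natCast, pow_mul, (det_denom_of_blockC_eq_zero hC _).1, one_pow, inv_one]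
    rw [poincareTerm_eq, slash, hz, hr, Complex.ofReal_re, one_mul]
  · rw [limitTerm, if_neg hC, Complex.ofReal_zero]
    refine Tendsto.mono_left ?_ inf_le_left
    rw [tendsto_zero_iff_norm_tendsto_zero]
    simp_rw [norm_poincareTerm]
    have h1 := one_lt_norm_det_denom q.out hC
    have h2 : Tendsto (fun l : ℕ => (‖(denom q.out basePoint).det‖ ^ (k + l))⁻¹) atTop (𝓝 0) :=
      tendsto_inv_atTop_zero.comp ((tendsto_pow_atTop_atTop_of_one_lt h1).comp
        (tendsto_atTop_mono (fun l => Nat.le_add_left l k) tendsto_id))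
    simpa using h2.mul_const ‖seed k T T' (act q.out basePoint)‖

theorem norm_poincareTerm_anti {k l l' : ℕ} (h : l ≤ l') {T T' : Mat2 ℝ} (hT : IsHalfIntegral T)
    (hT' : IsHalfIntegral T') (q : Quotient (QuotientGroup.rightRel translations)) :
    ‖poincareTerm k l' T T' hT hT' basePoint q‖ ≤ ‖poincareTerm k l T T' hT hT' basePoint q‖ := by
  rw [norm_poincareTerm, norm_poincareTerm]
  have h1 := one_le_norm_det_denom q.out
  gcongr

theorem limitTerm_nonneg {k : ℕ} (hk : 0 < k) {T T' : Mat2 ℝ} (hT : IsHalfIntegral T)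
    (hT' : IsHalfIntegral T') (hTp : T.PosDef)
    (q : Quotient (QuotientGroup.rightRel translations)) : 0 ≤ limitTerm k T T' q := by
  rw [limitTerm]
  split_ifs with hC
  · obtain ⟨r, hr0, hr⟩ := seed_act_pos hk hT hT' hTp q.out hC
    rw [hr]
    exact hr0.le
  · exact le_rfl

theorem limitTerm_le (k l : ℕ) {T T' : Mat2 ℝ} (hT : IsHalfIntegral T) (hT' : IsHalfIntegral T')
    (q : Quotient (QuotientGroup.rightRel translations)) :
    limitTerm k T T' q ≤ ‖poincareTerm k l T T' hT hT' basePoint q‖ := by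
  rw [limitTerm]
  split_ifs with hC
  · rw [norm_poincareTerm, (det_denom_of_blockC_eq_zero hC _).2, one_pow, inv_one, one_mul]
    exact Complex.re_le_norm _
  · exact norm_nonneg _

theorem limitTerm_one_pos {k : ℕ} (hk : 0 < k) {T T' : Mat2 ℝ} (hT : IsHalfIntegral T)
    (hT' : IsHalfIntegral T') (hTp : T.PosDef) :
    0 < limitTerm k T T' (Quotient.mk (QuotientGroup.rightRel translations) 1) := by
  set q := Quotient.mk (QuotientGroup.rightRel translations) (1 : Gam) with hq
  have hmem : (1 : Gam) * q.out⁻¹ ∈ translations :=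
    QuotientGroup.rightRel_apply.1 (Quotient.exact (Quotient.out_eq q))
  obtain ⟨B, -, hB⟩ := mem_translations.1 hmem
  have hC : blockC q.out = 0 := by
    rw [← (blocks_translate hB).2.2.1, ← intC_eq_zero_iff]
    ext i j
    fin_cases i <;> fin_cases j <;> rfl
  obtain ⟨r, hr0, hr⟩ := seed_act_pos hk hT hT' hTp q.out hC
  rw [limitTerm, if_pos hC, hr]
  exact hr0

end SiegelPoincare
end

theorem mainTheorem2 :
    ∃ y₀ : ℝ, 1 < y₀ ∧
      ∀ (k : ℕ), 0 < k → Even k →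
      ∀ (T T' : SiegelPoincare.Mat2 ℝ) (hT : SiegelPoincare.IsHalfIntegral T)
        (hT' : SiegelPoincare.IsHalfIntegral T'), T.PosDef → T'.PosDef →
        -- the limit over even `ℓ` of the values at `i y₀ I` exists and is a positive real number
        (∃ L : ℝ, 0 < L ∧
          Tendsto (fun l : ℕ => SiegelPoincare.poincareSeries k l T T' hT hT'
              ((Complex.I * (y₀ : ℂ)) • (1 : SiegelPoincare.Mat2 ℂ)))
            (atTop ⊓ 𝓟 {l : ℕ | Even l}) (𝓝 (L : ℂ))) ∧
        -- for all large even `ℓ` the series converges absolutely on the Siegel upper half space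
        -- and does not vanish identically there
        ∃ l₀ : ℕ, ∀ l : ℕ, l₀ ≤ l → Even l →
          (∀ Z ∈ SiegelPoincare.upperHalfSpace,
            Summable (fun q => ‖SiegelPoincare.poincareTerm k l T T' hT hT' Z q‖)) ∧
          ∃ Z ∈ SiegelPoincare.upperHalfSpace,
            SiegelPoincare.poincareSeries k l T T' hT hT' Z ≠ 0 := by
  refine ⟨2, one_lt_two, fun k hk hke T T' hT hT' hTp hTp' => ?_⟩
  have hsum := SiegelPoincare.summable_norm_poincareTerm hk le_rfl hT hT' hTp hTp'
    SiegelPoincare.basePoint_mem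
  have hlim : Tendsto
      (fun l : ℕ => SiegelPoincare.poincareSeries k l T T' hT hT' SiegelPoincare.basePoint)
      (atTop ⊓ 𝓟 {l : ℕ | Even l})
      (𝓝 ((∑' q, SiegelPoincare.limitTerm k T T' q : ℝ) : ℂ)) := by
    rw [Complex.ofReal_tsum]
    refine tendsto_tsum_of_dominated_convergence hsum
      (SiegelPoincare.tendsto_poincareTerm hk hke hT hT' hTp) ?_
    exact ((eventually_ge_atTop _).mono fun l hl q =>
      SiegelPoincare.norm_poincareTerm_anti hl hT hT' q).filter_mono inf_le_left
  have hpos : 0 < ∑' q, SiegelPoincare.limitTerm k T T' q :=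
    (hsum.of_nonneg_of_le (SiegelPoincare.limitTerm_nonneg hk hT hT' hTp)
      (SiegelPoincare.limitTerm_le k _ hT hT')).tsum_pos
      (SiegelPoincare.limitTerm_nonneg hk hT hT' hTp) _
      (SiegelPoincare.limitTerm_one_pos hk hT hT' hTp)
  refine ⟨⟨_, hpos, hlim⟩, ?_⟩
  have hne := hlim.eventually_ne (Complex.ofReal_ne_zero.2 hpos.ne')
  rw [eventually_inf_principal, eventually_atTop] at hne
  obtain ⟨l₁, hl₁⟩ := hne
  refine ⟨max l₁ (3 * k + 24), fun l hl hle => ⟨fun Z hZ => ?_, ?_⟩⟩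
  · exact SiegelPoincare.summable_norm_poincareTerm hk ((le_max_right _ _).trans hl)
      hT hT' hTp hTp' hZ
  · exact ⟨_, SiegelPoincare.basePoint_mem, hl₁ l ((le_max_left _ _).trans hl) hle⟩
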